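/- Let $G$ be a finite connected 1-dimensional cell complex (a graph; loops and multiple edges allowed) in which no vertex has degree $2$ and which has at least one branched vertex, i.e. a vertex of degree $\ge 3$ (equivalently: $G$ carries its natural cell structure and is homeomorphic neither to an interval nor to a circle). A free vertex is a vertex of degree $1$; a free edge is an edge with a free endpoint. Fix a characteristic map $[0,1]\to G$ of each edge, hence a positive orientation of each edge; each edge thus gives two oriented edges. Let $n\ge 0$ and let $\mathrm{Conf}_n(G)=\{(x_1,\dots,x_n)\in G^n : x_i\ne x_j \text{ for } i\neq j\}$ with the subspace topology. For $A\subseteq \mathrm{Conf}_n(G)$, an identifying function on $A$ is a continuous map $f:A\to G$ with $f(x)\neq x_j$ for all $x=(x_1,\dots,x_n)\in A$ and all $j$. A $k$-face $F$ associates to each edge $e$ an ordered tuple $F(\bar e)$ of indices from $\{1,\dots,n\}$, to each branched vertex $v$ at most one index $F(v)$, and to exactly $k$ oriented edges $e$ whose head $v_e$ is a branched vertex an index $F(e)$, such that each index occurs exactly once in total and such that, for each branched vertex $v$, there is at most one index of the form $F(v)$ or $F(e)$ with $v_e=v$. The face $F$ determines an embedded cube $[0,1]^k\to\mathrm{Conf}_n(G)$,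 with one coordinate $s_e$ for each oriented edge $e$ such that $F(e)$ exists, as follows. The token $F(v)$ is at $v$. On each edge lie, in this order along its positive orientation, the token of the negatively oriented edge (if any), the tokens of the tuple $F(\bar e)$, and the token of the positively oriented edge (if any). All gaps between consecutive tokens, and between an end of the edge and the nearest token, are equal, except that the gap between the token $F(e)$ and the end $v_e$ is $(1-s_e)$ times the common gap; so $s_e=1$ puts this token at $v_e$. The subspace $K_n(G)\subseteq \mathrm{Conf}_n(G)$ is the union of these cubes; its vertices ($0$-skeleton) are the configurations given by the $0$-faces, in which the tokens on each edge are evenly spaced. Let $A\subseteq K_n(G)$ contain the $0$-skeleton of $K_n(G)$. An identifying function $f$ on $A$ is called extendable if there are no free edge $e$, branched endpoint $v$ of $e$, and vertex $F$ of $K_n(G)$ such that $F(v)$ exists, $F(\bar e)$ is empty, and $f(F)\in e$. Then: 1. An identifying function on $K_n(G)$ extends to an identifying function on $\mathrm{Conf}_n(G)$ if and only if it is extendable. 2. More generally, if $A\subseteq K_n(G)$ contains the $0$-skeleton and an identifying function on $A$ extends to an identifying function on $\mathrm{Conf}_n(G)$, then it is extendable. 3. In particular, if $G$ has no free vertices,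 then every identifying function on $K_n(G)$ extends to an identifying function on $\mathrm{Conf}_n(G)$. -/

import Mathlib

open Set Topology

/-- The combinatorial data of a 1-dimensional cell complex with vertex set `V` and edge set `E`
(loops and multiple edges allowed). Each edge carries a fixed positive orientation, from `src e`
to `tgt e`. -/
structure CellGraph (V E : Type*) where
  src : E → V
  tgt : E → V

namespace CellGraph

variable {V E : Type*} (G : CellGraph V E)

/-- The underlying set of the cell complex: the disjoint union of its open cells. -/
inductive Point (G : CellGraph V E) : Type _
  | vertex (v : V) : Point G
  | interior (e : E) (t : Ioo (0 : ℝ) 1) : Point G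

open Classical in
/-- The characteristic map of the edge `e`, which runs from `src e` at time `0` to `tgt e` at
time `1` (and is constant outside `[0, 1]`). -/
noncomputable def edgePoint (e : E) (t : ℝ) : G.Point :=
  if h : t ∈ Ioo (0 : ℝ) 1 then .interior e ⟨t, h⟩
  else if t ≤ 0 then .vertex (G.src e) else .vertex (G.tgt e)

/-- The cell complex topology: a set is open if and only if its preimage under the characteristic
map `[0, 1] → G` of every edge is open. -/
noncomputable instance : TopologicalSpace G.Point :=
  ⨆ e : E, TopologicalSpace.coinduced (fun t : unitInterval => G.edgePoint e t) inferInstance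

/-- The closed edge `e` as a subset of the graph. -/
def closedEdge (e : E) : Set G.Point := G.edgePoint e '' Icc 0 1

/-- Oriented edges: `(e, true)` is `e` with its positive orientation, `(e, false)` is `e` with the
opposite one. -/
abbrev OrientedEdge (_ : CellGraph V E) : Type _ := E × Bool

/-- The endpoint towards which an oriented edge is pointing. -/
def head (o : G.OrientedEdge) : V := if o.2 then G.tgt o.1 else G.src o.1

/-- The degree of a vertex; a loop counts twice. -/
noncomputable def degree (v : V) : ℕ := Nat.card {o : G.OrientedEdge // G.head o = v}

def IsBranched (v : V) : Prop := 3 ≤ G.degree v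

def IsFree (v : V) : Prop := G.degree v = 1

def IsEndpoint (v : V) (e : E) : Prop := G.src e = v ∨ G.tgt e = v

end CellGraph

/-- The `n`-th ordered configuration space of `X`, with the topology induced from `X ^ n`. -/
def Conf (n : ℕ) (X : Type*) : Type _ := {x : Fin n → X // Function.Injective x}

instance (n : ℕ) (X : Type*) [TopologicalSpace X] : TopologicalSpace (Conf n X) :=
  inferInstanceAs (TopologicalSpace {x : Fin n → X // Function.Injective x})

namespace CellGraph

variable {V E : Type*} {G : CellGraph V E} {n : ℕ}

/-- The places to which a face can associate indices: the entries of the tuples at the (positively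
oriented) edges, the vertices, and the oriented edges. -/
abbrev Slot (G : CellGraph V E) (n : ℕ) (onEdge : E → List (Fin n)) : Type _ :=
  (Σ e : E, Fin (onEdge e).length) ⊕ V ⊕ G.OrientedEdge

/-- The index (if any) at a given place. -/
def slotLabel (onEdge : E → List (Fin n)) (atVertex : V → Option (Fin n))
    (moving : G.OrientedEdge → Option (Fin n)) : G.Slot n onEdge → Option (Fin n)
  | .inl c => some ((onEdge c.1).get c.2)
  | .inr (.inl v) => atVertex v
  | .inr (.inr o) => moving o

/-- The faces of the combinatorial model of `Conf n G`: elements of the graded poset `P_n(G)`. -/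
structure Face (G : CellGraph V E) (n : ℕ) where
  /-- the ordered tuple of indices at each positively oriented edge -/
  onEdge : E → List (Fin n)
  /-- the index, if any, at each vertex -/
  atVertex : V → Option (Fin n)
  /-- the index, if any, at each oriented edge: a token that can move from the interior of the
  edge to its head -/
  moving : G.OrientedEdge → Option (Fin n)
  /-- only branched vertices carry an index -/
  atVertex_branched : ∀ v, (atVertex v).isSome → G.IsBranched v
  /-- only oriented edges pointing to branched vertices carry an index -/
  moving_branched : ∀ o, (moving o).isSome → G.IsBranched (G.head o)
  /-- each index occurs exactly once -/
  occurs_once : ∀ i : Fin n, ∃! c : G.Slot n onEdge, slotLabel onEdge atVertex moving c = some i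
  /-- for each vertex `v`, at most one index is associated to `v` or to the oriented edges with
  head `v` -/
  atVertex_eq_none : ∀ o, (moving o).isSome → atVertex (G.head o) = none
  moving_unique : ∀ o o', (moving o).isSome → (moving o').isSome → G.head o = G.head o' → o = o'

namespace Face

/-- The dimension of a face. -/
noncomputable def dim (F : G.Face n) : ℕ := Nat.card {o : G.OrientedEdge // (F.moving o).isSome}

/-- The cube `[0, 1]^k` of a `k`-face, with one coordinate for each moving token. Coordinate `0`
means that the token is stationary in the interior of its edge (the face `F_e^-`), coordinate `1`
means that it is at the head of the oriented edge (the face `F_e^+`). -/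
abbrev Cube (F : G.Face n) : Type _ := {o : G.OrientedEdge // (F.moving o).isSome} → unitInterval

/-- The distance from the head of `o` to the moving token on `o`, measured in units of the spacing
of the tokens on that edge (`1` if there is no such token). -/
def gap (F : G.Face n) (s : F.Cube) (o : G.OrientedEdge) : ℝ :=
  if h : (F.moving o).isSome then 1 - s ⟨o, h⟩ else 1

/-- The distance from the head of `o` to the nearest stationary token in the interior of that edge,
in the same units. -/
def margin (F : G.Face n) (s : F.Cube) (o : G.OrientedEdge) : ℝ :=
  if (F.moving o).isSome then F.gap s o + 1 else 1

/-- The length of the edge `e` in the same units. -/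
def units (F : G.Face n) (s : F.Cube) (e : E) : ℝ :=
  F.margin s (e, false) + (F.onEdge e).length + F.margin s (e, true) - 1

/-- The location in `G` of the token at a given place. On each edge, consecutive tokens are equally
spaced; so is the gap between an outermost token and the end of the edge, except that it is scaled
by `1 - s` if the token is moving to that end with parameter `s`. -/
noncomputable def slotPoint (F : G.Face n) (s : F.Cube) : G.Slot n F.onEdge → G.Point
  | .inl c => G.edgePoint c.1 ((F.margin s (c.1, false) + (c.2 : ℕ)) / F.units s c.1)
  | .inr (.inl v) => .vertex v
  | .inr (.inr (e, false)) => G.edgePoint e (F.gap s (e, false) / F.units s e)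
  | .inr (.inr (e, true)) => G.edgePoint e (1 - F.gap s (e, true) / F.units s e)

/-- The label function of a face. -/
def label (F : G.Face n) : G.Slot n F.onEdge → Option (Fin n) :=
  slotLabel F.onEdge F.atVertex F.moving

/-- The unique place at which the index `i` occurs. -/
noncomputable def slotOf (F : G.Face n) (i : Fin n) : G.Slot n F.onEdge :=
  (F.occurs_once i).choose

theorem label_slotOf (F : G.Face n) (i : Fin n) : F.label (F.slotOf i) = some i :=
  (F.occurs_once i).choose_spec.1

theorem gap_nonneg (F : G.Face n) (s : F.Cube) (o) : 0 ≤ F.gap s o := by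
  unfold gap
  split_ifs with h
  · linarith [(s ⟨o, h⟩).2.2]
  · norm_num

theorem margin_of_isSome (F : G.Face n) (s : F.Cube) {o} (h : (F.moving o).isSome) :
    F.margin s o = F.gap s o + 1 := by simp [margin, h]

theorem one_le_margin (F : G.Face n) (s : F.Cube) (o) : 1 ≤ F.margin s o := by
  unfold margin
  split_ifs
  · linarith [F.gap_nonneg s o]
  · rfl

theorem units_pos (F : G.Face n) (s : F.Cube) (e) : 0 < F.units s e := by
  unfold units
  have := F.one_le_margin s (e, false)
  have := F.one_le_margin s (e, true)
  have : (0 : ℝ) ≤ (F.onEdge e).length := Nat.cast_nonneg _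
  linarith

theorem edgePoint_interior {e : E} {t : ℝ} (h : t ∈ Ioo (0 : ℝ) 1) :
    G.edgePoint e t = .interior e ⟨t, h⟩ := by
  unfold edgePoint; rw [dif_pos h]

/-- A stationary token on an edge lies in its interior. -/
theorem slotPoint_inl (F : G.Face n) (s : F.Cube) (c) : ∃ h,
    F.slotPoint s (.inl c) =
      .interior c.1 ⟨(F.margin s (c.1, false) + (c.2 : ℕ)) / F.units s c.1, h⟩ := by
  have hu := F.units_pos s c.1
  have h1 := F.one_le_margin s (c.1, false)
  have h2 := F.one_le_margin s (c.1, true)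
  have h3 : ((c.2 : ℕ) : ℝ) + 1 ≤ (F.onEdge c.1).length := by exact_mod_cast c.2.2
  have h4 : (0 : ℝ) ≤ (c.2 : ℕ) := Nat.cast_nonneg _
  have h : (F.margin s (c.1, false) + (c.2 : ℕ)) / F.units s c.1 ∈ Ioo (0 : ℝ) 1 := by
    refine ⟨by positivity, ?_⟩
    rw [div_lt_one hu, units]; linarith
  exact ⟨h, edgePoint_interior h⟩

/-- The coordinate of a moving token on its edge. -/
noncomputable def movingCoord (F : G.Face n) (s : F.Cube) (o : G.OrientedEdge) : ℝ :=
  if o.2 then 1 - F.gap s o / F.units s o.1 else F.gap s o / F.units s o.1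

/-- A moving token is at the head of its oriented edge or in the interior of the edge. -/
theorem slotPoint_moving (F : G.Face n) (s : F.Cube) (o) (ho : (F.moving o).isSome) :
    F.slotPoint s (.inr (.inr o)) = .vertex (G.head o) ∨
    ∃ h, F.slotPoint s (.inr (.inr o)) = .interior o.1 ⟨F.movingCoord s o, h⟩ := by
  obtain ⟨e, b⟩ := o
  have hu := F.units_pos s e
  have h0 := F.gap_nonneg s (e, b)
  have h1 := F.one_le_margin s (e, false)
  have h2 := F.one_le_margin s (e, true)
  have h4 : (0 : ℝ) ≤ (F.onEdge e).length := Nat.cast_nonneg _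
  have h3 := F.margin_of_isSome s ho
  have hlt : F.gap s (e, b) / F.units s e < 1 := by
    rw [div_lt_one hu, units]
    cases b <;> linarith
  rcases h0.eq_or_lt with h | h
  · left
    cases b <;> simp [slotPoint, ← h, edgePoint, head]
  · right
    have hp : 0 < F.gap s (e, b) / F.units s e := div_pos h hu
    have hm : F.movingCoord s (e, b) ∈ Ioo (0 : ℝ) 1 := by
      cases b <;> simp only [movingCoord, mem_Ioo] <;> constructor <;> simp <;> linarith
    refine ⟨hm, ?_⟩
    rw [← edgePoint_interior hm]
    cases b <;> simp [slotPoint, movingCoord]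

theorem coord_ne (F : G.Face n) (s : F.Cube) (o : G.OrientedEdge) (ho : (F.moving o).isSome)
    (k : Fin (F.onEdge o.1).length) :
    (F.margin s (o.1, false) + (k : ℕ)) / F.units s o.1 ≠ F.movingCoord s o := by
  obtain ⟨e, b⟩ := o
  have hu := F.units_pos s e
  have h3 := F.margin_of_isSome s ho
  have hk : ((k : ℕ) : ℝ) + 1 ≤ (F.onEdge e).length := by exact_mod_cast k.2
  have hk0 : (0 : ℝ) ≤ (k : ℕ) := Nat.cast_nonneg _
  intro h
  cases b
  · simp only [movingCoord, Bool.false_eq_true, if_false] at h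
    rw [div_left_inj' hu.ne'] at h
    linarith
  · simp only [movingCoord, if_true] at h
    rw [eq_sub_iff_add_eq, ← add_div, div_eq_one_iff_eq hu.ne', units] at h
    simp only at hk hk0 h
    linarith

theorem movingCoord_ne (F : G.Face n) (s : F.Cube) (e : E) (h0 : (F.moving (e, false)).isSome)
    (h1 : (F.moving (e, true)).isSome) :
    F.movingCoord s (e, false) ≠ F.movingCoord s (e, true) := by
  have hu := F.units_pos s e
  have h3 := F.margin_of_isSome s h0
  have h4 := F.margin_of_isSome s h1
  have h5 : (0 : ℝ) ≤ (F.onEdge e).length := Nat.cast_nonneg _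
  intro h
  simp only [movingCoord, Bool.false_eq_true, if_false, if_true] at h
  rw [eq_sub_iff_add_eq, ← add_div, div_eq_one_iff_eq hu.ne', units] at h
  linarith

theorem inl_ne_moving (F : G.Face n) (s : F.Cube) (c o) (ho : (F.moving o).isSome) :
    F.slotPoint s (.inl c) ≠ F.slotPoint s (.inr (.inr o)) := by
  intro h
  obtain ⟨h1, e1⟩ := F.slotPoint_inl s c
  rcases F.slotPoint_moving s o ho with e2 | ⟨h2, e2⟩
  · rw [e1, e2] at h; cases h
  · rw [e1, e2] at h
    obtain ⟨e, k⟩ := c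
    obtain ⟨e', b⟩ := o
    simp only [Point.interior.injEq, Subtype.mk.injEq] at h
    obtain ⟨rfl, h⟩ := h
    exact F.coord_ne s (e, b) ho k h

theorem vertex_ne_moving (F : G.Face n) (s : F.Cube) (v o) (hv : (F.atVertex v).isSome)
    (ho : (F.moving o).isSome) :
    F.slotPoint s (.inr (.inl v)) ≠ F.slotPoint s (.inr (.inr o)) := by
  intro h
  rcases F.slotPoint_moving s o ho with e2 | ⟨h2, e2⟩
  · rw [e2] at h
    simp only [slotPoint, Point.vertex.injEq] at h
    subst h
    simp [F.atVertex_eq_none o ho] at hv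
  · rw [e2] at h; cases h

theorem slotPoint_inj (F : G.Face n) (s : F.Cube) (c c') (hc : (F.label c).isSome)
    (hc' : (F.label c').isSome) (h : F.slotPoint s c = F.slotPoint s c') : c = c' := by
  rcases c with c | v | o <;> rcases c' with c' | v' | o'
  · obtain ⟨h1, e1⟩ := F.slotPoint_inl s c
    obtain ⟨h2, e2⟩ := F.slotPoint_inl s c'
    rw [e1, e2] at h
    obtain ⟨e, k⟩ := c
    obtain ⟨e', k'⟩ := c'
    simp only [Point.interior.injEq, Subtype.mk.injEq] at h
    obtain ⟨rfl, h⟩ := h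
    rw [div_left_inj' (F.units_pos s e).ne', add_right_inj, Nat.cast_inj] at h
    rw [Fin.ext h]
  · obtain ⟨h1, e1⟩ := F.slotPoint_inl s c
    rw [e1] at h; cases h
  · exact absurd h (F.inl_ne_moving s c o' hc')
  · obtain ⟨h1, e1⟩ := F.slotPoint_inl s c'
    rw [e1] at h; cases h
  · simp only [slotPoint, Point.vertex.injEq] at h
    rw [h]
  · exact absurd h (F.vertex_ne_moving s v o' hc hc')
  · exact absurd h.symm (F.inl_ne_moving s c' o hc)
  · exact absurd h.symm (F.vertex_ne_moving s v' o hc' hc)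
  · have hc : (F.moving o).isSome := hc
    have hc' : (F.moving o').isSome := hc'
    congr 2
    rcases F.slotPoint_moving s o hc with e1 | ⟨h1, e1⟩ <;>
    rcases F.slotPoint_moving s o' hc' with e2 | ⟨h2, e2⟩ <;> rw [e1, e2] at h
    · exact F.moving_unique o o' hc hc' (by simpa using h)
    · cases h
    · cases h
    · obtain ⟨e, b⟩ := o
      obtain ⟨e', b'⟩ := o'
      simp only [Point.interior.injEq, Subtype.mk.injEq] at h
      obtain ⟨rfl, h⟩ := h
      cases b <;> cases b'
      · rfl
      · exact absurd h (F.movingCoord_ne s e hc hc')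
      · exact absurd h.symm (F.movingCoord_ne s e hc' hc)
      · rfl

/-- The characteristic map of the cell of the face `F`: the embedding of the cube of `F` into the
configuration space. -/
noncomputable def cellMap (F : G.Face n) (s : F.Cube) : Conf n G.Point :=
  ⟨fun i => F.slotPoint s (F.slotOf i), fun i j h => by
    have := F.slotPoint_inj s _ _ (by simp [label_slotOf]) (by simp [label_slotOf]) h
    have h2 := congrArg F.label this
    simpa [label_slotOf] using h2⟩

end Face

/-- A vertex of the cube complex `K_n(G)`, that is, a face of dimension `0`, as a configuration:
the tokens on each edge are evenly spaced. -/
noncomputable def Face.vertexConf (F : G.Face n) : Conf n G.Point := F.cellMap fun _ => 0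

/-- The cube complex `K_n(G)`, embedded in the configuration space: the union of its cells. -/
def cubeComplex (G : CellGraph V E) (n : ℕ) : Set (Conf n G.Point) :=
  {x | ∃ (F : G.Face n) (s : F.Cube), F.cellMap s = x}

/-- The `0`-skeleton of `K_n(G)`. -/
def zeroSkeleton (G : CellGraph V E) (n : ℕ) : Set (Conf n G.Point) :=
  {x | ∃ F : G.Face n, F.dim = 0 ∧ F.vertexConf = x}

theorem zeroSkeleton_subset (G : CellGraph V E) (n : ℕ) :
    G.zeroSkeleton n ⊆ G.cubeComplex n := by
  rintro x ⟨F, -, rfl⟩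
  exact ⟨F, _, rfl⟩

end CellGraph

/-- A partially defined identifying function, with domain `A ⊆ Conf n X`: a continuous function
whose value at a configuration is never one of its tokens. -/
def IsIdentifyingOn {n : ℕ} {X : Type*} [TopologicalSpace X] (A : Set (Conf n X)) (f : A → X) :
    Prop :=
  Continuous f ∧ ∀ (x : A) (j : Fin n), f x ≠ x.1.1 j

/-- An identifying function on the whole configuration space. -/
def IsIdentifying {n : ℕ} {X : Type*} [TopologicalSpace X] (g : Conf n X → X) : Prop :=
  Continuous g ∧ ∀ (x : Conf n X) (j : Fin n), g x ≠ x.1 j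

/-- `f` is the restriction to `A` of an identifying function on `Conf n X`. -/
def ExtendsToConf {n : ℕ} {X : Type*} [TopologicalSpace X] (A : Set (Conf n X)) (f : A → X) :
    Prop :=
  ∃ g : Conf n X → X, IsIdentifying g ∧ ∀ x : A, g x.1 = f x

namespace CellGraph

variable {V E : Type*} {G : CellGraph V E} {n : ℕ}

/-- `f` is extendable if there are no free edge `e` (with a free endpoint `u`), branched endpoint
`v` of `e`, and vertex `F` of `K_n(G)` such that `F` occupies `v`, has no token on `e`, and is sent
into `e` by `f`. -/
def IsExtendable (A : Set (Conf n G.Point)) (hA : G.zeroSkeleton n ⊆ A) (f : A → G.Point) : Prop :=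
  ¬ ∃ (e : E) (u v : V) (F : G.Face n) (hF : F.dim = 0),
    G.IsEndpoint u e ∧ G.IsFree u ∧ G.IsEndpoint v e ∧ G.IsBranched v ∧
    (F.atVertex v).isSome ∧ F.onEdge e = [] ∧
    f ⟨F.vertexConf, hA ⟨F, hF, rfl⟩⟩ ∈ G.closedEdge e

end CellGraph

/-!
Reading a configuration in edge coordinates and spreading its tokens evenly along the edges, where
the gap between the outermost token and a branched end of an edge is scaled according to how close
that token is compared with the tokens on the other edges at the same vertex, retracts `Conf_n(G)`
onto `K_n(G)`. Between two consecutive tokens the spreading is an affine map of intervals, and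
transporting the value of `f` at the retracted configuration back along these maps gives the
extension. The only obstruction is a token that spreading moves away from a free vertex, if the
value of `f` lies in the gap thus opened. Whether it does so is constant along the cubes of
`K_n(G)`. Pushing the other tokens of the free edge out through its branched end, one after the
other, one arrives at a vertex of `K_n(G)` of the kind that extendability excludes.

Conversely, at a vertex of `K_n(G)` that violates extendability, let the token at the branched
vertex run through the empty free edge to its free end: on the way it collides with the value of
any extension, which starts on that edge.
-/

namespace CellGraph

variable {V E : Type*} (G : CellGraph V E)

/-! ### Characteristic maps -/

/-- The characteristic maps of all edges, assembled into one map. -/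
noncomputable def chart (p : E × unitInterval) : G.Point := G.edgePoint p.1 p.2

/-- The end of the edge `o.1` at which the oriented edge `o` has its head. -/
def endOf (o : E × Bool) : E × unitInterval := (o.1, if o.2 then 1 else 0)

@[simp] theorem endOf_fst (o : E × Bool) : (endOf o).1 = o.1 := rfl

theorem endOf_injective : Function.Injective (endOf : E × Bool → E × unitInterval) := by
  rintro ⟨e, b⟩ ⟨e', b'⟩ h
  cases b <;> cases b' <;> simp_all [endOf]

theorem endOf_notMem_Ioo (o : E × Bool) : ((endOf o).2 : ℝ) ∉ Ioo (0 : ℝ) 1 := by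
  obtain ⟨e, b⟩ := o
  cases b <;> simp [endOf]

theorem eq_endOf_or_mem_Ioo (p : E × unitInterval) :
    (∃ b, p = endOf (p.1, b)) ∨ (p.2 : ℝ) ∈ Ioo (0 : ℝ) 1 := by
  obtain ⟨e, t⟩ := p
  rcases t.2.1.eq_or_lt with h | h
  · exact .inl ⟨false, by ext <;> simp [endOf, ← h]⟩
  rcases t.2.2.eq_or_lt with h' | h'
  · exact .inl ⟨true, by ext <;> simp [endOf, h']⟩
  · exact .inr ⟨h, h'⟩

theorem chart_endOf (o : G.OrientedEdge) : G.chart (endOf o) = .vertex (G.head o) := by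
  obtain ⟨e, b⟩ := o
  cases b <;> simp [chart, endOf, edgePoint, head]

theorem chart_of_mem_Ioo {p : E × unitInterval} (h : (p.2 : ℝ) ∈ Ioo (0 : ℝ) 1) :
    G.chart p = .interior p.1 ⟨p.2, h⟩ :=
  dif_pos h

variable {G} in
theorem eq_or_endOf_of_chart_eq {p p' : E × unitInterval} (h : G.chart p = G.chart p') :
    p = p' ∨ ∃ o o', p = endOf o ∧ p' = endOf o' ∧ G.head o = G.head o' := by
  rcases eq_endOf_or_mem_Ioo p with ⟨b, hp⟩ | hp <;>
  rcases eq_endOf_or_mem_Ioo p' with ⟨b', hp'⟩ | hp'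
  · rw [hp, hp', chart_endOf, chart_endOf] at h
    exact .inr ⟨_, _, hp, hp', Point.vertex.inj h⟩
  · rw [hp, chart_endOf, chart_of_mem_Ioo _ hp'] at h; cases h
  · rw [hp', chart_endOf, chart_of_mem_Ioo _ hp] at h; cases h
  · rw [chart_of_mem_Ioo _ hp, chart_of_mem_Ioo _ hp'] at h
    simp only [Point.interior.injEq, Subtype.mk.injEq] at h
    exact .inl (Prod.ext h.1 (Subtype.ext h.2))

variable {G} in
theorem eq_of_chart_eq_of_mem_Ioo {p p' : E × unitInterval} (hp : (p.2 : ℝ) ∈ Ioo (0 : ℝ) 1)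
    (h : G.chart p = G.chart p') : p = p' := by
  rcases eq_or_endOf_of_chart_eq h with h | ⟨o, o', rfl, -, -⟩
  · exact h
  · exact absurd hp (endOf_notMem_Ioo o)

theorem chart_surjective (hG : Function.Surjective G.head) : Function.Surjective G.chart := by
  rintro (v | ⟨e, t⟩)
  · obtain ⟨o, rfl⟩ := hG v
    exact ⟨_, G.chart_endOf o⟩
  · exact ⟨(e, ⟨t, t.2.1.le, t.2.2.le⟩), G.chart_of_mem_Ioo t.2⟩

theorem chart_mem_closedEdge (e : E) (t : unitInterval) : G.chart (e, t) ∈ G.closedEdge e :=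
  ⟨t, t.2, rfl⟩

theorem closedEdge_eq_image_chart (e : E) : G.closedEdge e = G.chart '' {p | p.1 = e} := by
  ext y
  constructor
  · rintro ⟨t, ht, rfl⟩
    exact ⟨(e, ⟨t, ht⟩), rfl, rfl⟩
  · rintro ⟨⟨e', t⟩, rfl, rfl⟩
    exact G.chart_mem_closedEdge _ t

/-! ### The topology of the graph -/

theorem continuous_edgePoint (e : E) : Continuous fun t : unitInterval => G.edgePoint e t :=
  continuous_iff_coinduced_le.2 (le_iSup (fun e : E => TopologicalSpace.coinduced
    (fun t : unitInterval => G.edgePoint e t) inferInstance) e)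

theorem continuous_point_iff {X : Type*} [TopologicalSpace X] {f : G.Point → X} :
    Continuous f ↔ ∀ e, Continuous fun t : unitInterval => f (G.edgePoint e t) :=
  continuous_iSup_dom.trans (forall_congr' fun _ => continuous_coinduced_dom)

theorem isClosed_point_iff {s : Set G.Point} :
    IsClosed s ↔ ∀ e, IsClosed {t : unitInterval | G.edgePoint e t ∈ s} :=
  isClosed_iSup_iff.trans (forall_congr' fun _ => isClosed_coinduced)

theorem isOpen_point_iff {s : Set G.Point} :
    IsOpen s ↔ ∀ e, IsOpen {t : unitInterval | G.edgePoint e t ∈ s} :=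
  isOpen_iSup_iff.trans (forall_congr' fun _ => isOpen_coinduced)

section Chart

variable [TopologicalSpace E]

theorem continuous_chart [DiscreteTopology E] : Continuous G.chart :=
  continuous_prod_of_discrete_left.2 fun e => G.continuous_edgePoint e

theorem isClosedMap_chart : IsClosedMap G.chart := by
  intro C hC
  rw [isClosed_point_iff]
  intro e
  have hin : IsClosed {t : unitInterval | (e, t) ∈ C} := hC.preimage (by fun_prop)
  have hends : IsClosed ({t : unitInterval | G.edgePoint e t ∈ G.chart '' C} ∩ {0, 1}) :=
    (Set.Finite.subset (by simp) inter_subset_right).isClosed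
  convert hin.union hends using 1
  ext t
  constructor
  · intro ht
    rcases eq_endOf_or_mem_Ioo (e, t) with ⟨b, hb⟩ | hi
    · refine .inr ⟨ht, ?_⟩
      rw [show t = (endOf (e, b)).2 from congrArg Prod.snd hb]
      cases b <;> simp [endOf]
    · obtain ⟨p, hp, hpt⟩ := ht
      obtain rfl := eq_of_chart_eq_of_mem_Ioo hi hpt.symm
      exact .inl hp
  · rintro (ht | ht)
    · exact ⟨_, ht, rfl⟩
    · exact ht.1

theorem isProperMap_chart [DiscreteTopology E] [Finite E] : IsProperMap G.chart := by
  refine isProperMap_iff_isClosedMap_and_compact_fibers.2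
    ⟨G.continuous_chart, G.isClosedMap_chart, fun y => IsClosed.isCompact ?_⟩
  by_cases hy : y ∈ range G.chart
  · obtain ⟨p, rfl⟩ := hy
    have hp : IsClosed {G.chart p} := by
      rw [← image_singleton]
      exact G.isClosedMap_chart _ isClosed_singleton
    exact hp.preimage G.continuous_chart
  · rw [preimage_singleton_eq_empty.2 hy]
    exact isClosed_empty

end Chart

theorem isClosed_closedEdge (e : E) : IsClosed (G.closedEdge e) := by
  let _ : TopologicalSpace E := ⊥
  have : DiscreteTopology E := ⟨rfl⟩
  rw [closedEdge_eq_image_chart]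
  exact G.isClosedMap_chart _ ((isClosed_discrete {e}).preimage continuous_fst)

/-! ### Configurations in edge coordinates -/

/-- Configurations whose tokens are equipped with coordinates on an edge. A token at a vertex can be
placed at the corresponding end of any edge around that vertex, so that the projection `Lift.conf`
to the configuration space is not injective. -/
def Lift (n : ℕ) : Type _ := {z : Fin n → E × unitInterval // Function.Injective (G.chart ∘ z)}

variable {G} {n : ℕ}

instance [TopologicalSpace E] : TopologicalSpace (G.Lift n) :=
  inferInstanceAs (TopologicalSpace {z : Fin n → E × unitInterval //
    Function.Injective (G.chart ∘ z)})

namespace Lift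

/-- The configuration underlying a lift. -/
noncomputable def conf (z : G.Lift n) : Conf n G.Point := ⟨G.chart ∘ z.1, z.2⟩

theorem conf_surjective (hG : Function.Surjective G.head) :
    Function.Surjective (conf : G.Lift n → _) := by
  intro x
  choose z hz using fun i => G.chart_surjective hG (x.1 i)
  have hzx : G.chart ∘ z = x.1 := funext hz
  exact ⟨⟨z, hzx ▸ x.2⟩, Subtype.ext hzx⟩

variable [TopologicalSpace E] [DiscreteTopology E] [Finite E]

theorem isProperMap_conf : IsProperMap (conf : G.Lift n → _) := by
  have h : IsProperMap fun (z : Fin n → E × unitInterval) i => G.chart (z i) :=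
    IsProperMap.pi_map fun _ => G.isProperMap_chart
  exact h.restrictPreimage {x | Function.Injective x}

theorem isQuotientMap_conf (hG : Function.Surjective G.head) :
    IsQuotientMap (conf : G.Lift n → _) :=
  isProperMap_conf.isClosedMap.isQuotientMap isProperMap_conf.continuous (conf_surjective hG)

end Lift

theorem continuous_of_continuous_comp_lift [TopologicalSpace E] [DiscreteTopology E] [Finite E]
    (hG : Function.Surjective G.head) {X : Type*} [TopologicalSpace X]
    (S : Set (Conf n G.Point × G.Point)) (f : S → X)
    (hf : Continuous fun w : Prod.map Lift.conf G.chart ⁻¹' S => f ⟨_, w.2⟩) : Continuous f := by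
  have hp : IsProperMap (S.restrictPreimage (Prod.map (Lift.conf : G.Lift n → _) G.chart)) :=
    (Lift.isProperMap_conf.prodMap G.isProperMap_chart).restrictPreimage S
  have hsurj : Function.Surjective
      (S.restrictPreimage (Prod.map (Lift.conf : G.Lift n → _) G.chart)) :=
    Set.restrictPreimage_surjective _ ((Lift.conf_surjective hG).prodMap (G.chart_surjective hG))
  exact (hp.isClosedMap.isQuotientMap hp.continuous hsurj).continuous_iff.2 hf

/-! ### Free and branched vertices -/

theorem IsFree.not_isBranched {v : V} (h : G.IsFree v) : ¬ G.IsBranched v := by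
  unfold IsFree IsBranched at *
  omega

theorem IsFree.eq_of_head {v : V} (h : G.IsFree v) {o o' : G.OrientedEdge} (ho : G.head o = v)
    (ho' : G.head o' = v) : o = o' := by
  obtain ⟨hs, -⟩ := Nat.card_eq_one_iff_unique.1 h
  exact congrArg Subtype.val (Subsingleton.elim (⟨o, ho⟩ : {o // G.head o = v}) ⟨o', ho'⟩)

theorem exists_head_of_degree_ne_zero {v : V} (h : G.degree v ≠ 0) : ∃ o, G.head o = v := by
  obtain ⟨o⟩ : Nonempty {o : G.OrientedEdge // G.head o = v} :=
    not_isEmpty_iff.1 fun _ => h Nat.card_of_isEmpty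
  exact ⟨o.1, o.2⟩

theorem IsBranched.exists_ne [Finite E] {v : V} (h : G.IsBranched v) (o : G.OrientedEdge) :
    ∃ o', G.head o' = v ∧ o' ≠ o := by
  by_contra! hc
  have hsub : Subsingleton {o' : G.OrientedEdge // G.head o' = v} :=
    ⟨fun a b => Subtype.ext ((hc a.1 a.2).trans (hc b.1 b.2).symm)⟩
  have h1 : G.degree v ≤ 1 := Finite.card_le_one_iff_subsingleton.2 hsub
  have h3 : 3 ≤ G.degree v := h
  omega

theorem head_surjective (hV : ∀ v, G.IsFree v ∨ G.IsBranched v) : Function.Surjective G.head := by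
  intro v
  refine exists_head_of_degree_ne_zero ?_
  have := hV v
  unfold IsFree IsBranched at this
  omega

/-! ### Distances along an edge -/

/-- The distance of a point of an edge from the end `1` (for `true`) or `0` (for `false`). -/
def endDist (b : Bool) (t : unitInterval) : unitInterval := if b then unitInterval.symm t else t

theorem continuous_endDist (b : Bool) : Continuous (endDist b) := by
  cases b
  · exact continuous_id
  · exact unitInterval.continuous_symm

theorem endDist_not (b : Bool) (t : unitInterval) :
    endDist (!b) t = unitInterval.symm (endDist b t) := by
  cases b <;> simp [endDist]

theorem coe_endDist_not (b : Bool) (t : unitInterval) :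
    (endDist (!b) t : ℝ) = 1 - endDist b t := by
  rw [endDist_not, unitInterval.coe_symm_eq]

theorem endDist_endDist (b : Bool) (t : unitInterval) : endDist b (endDist b t) = t := by
  cases b <;> simp [endDist]

theorem endDist_injective (b : Bool) : Function.Injective (endDist b) :=
  Function.LeftInverse.injective (endDist_endDist b)

theorem endDist_not_lt_endDist_not {b : Bool} {s t : unitInterval} :
    endDist (!b) s < endDist (!b) t ↔ endDist b t < endDist b s := by
  rw [endDist_not, endDist_not, unitInterval.symm_lt_symm]

theorem endDist_endOf (o : E × Bool) : endDist o.2 (endOf o).2 = 0 := by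
  obtain ⟨e, b⟩ := o
  cases b <;> simp [endDist, endOf]

theorem endDist_not_endOf (e : E) (b : Bool) : endDist (!b) (endOf (e, b)).2 = 1 := by
  cases b <;> simp [endDist, endOf]

theorem endDist_endOf_eq_zero_or_one (b : Bool) (o : E × Bool) :
    endDist b (endOf o).2 = 0 ∨ endDist b (endOf o).2 = 1 := by
  obtain ⟨e, b'⟩ := o
  cases b <;> cases b' <;> simp [endDist, endOf]

theorem eq_endOf_of_endDist_eq_zero {o : E × Bool} {p : E × unitInterval} (h1 : p.1 = o.1)
    (h2 : endDist o.2 p.2 = 0) : p = endOf o :=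
  Prod.ext h1 (endDist_injective o.2 (h2.trans (endDist_endOf o).symm))

theorem isClopen_endDist_lt_endDist [TopologicalSpace E] [DiscreteTopology E] {W : Type*}
    [TopologicalSpace W] {p q : W → E × unitInterval} (hp : Continuous p) (hq : Continuous q)
    (hpq : ∀ w, q w ≠ p w) (b : Bool) :
    IsClopen {w | (q w).1 = (p w).1 ∧ endDist b (p w).2 < endDist b (q w).2} := by
  have hedge : IsClopen {w | (q w).1 = (p w).1} :=
    (isClopen_discrete {c : E × E | c.1 = c.2}).preimage
      ((continuous_fst.comp hq).prodMk (continuous_fst.comp hp))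
  have hp2 : Continuous fun w => endDist b (p w).2 :=
    (continuous_endDist b).comp (continuous_snd.comp hp)
  have hq2 : Continuous fun w => endDist b (q w).2 :=
    (continuous_endDist b).comp (continuous_snd.comp hq)
  have hlt : IsOpen {w | endDist b (p w).2 < endDist b (q w).2} := isOpen_lt hp2 hq2
  have hle : IsClosed {w | endDist b (p w).2 ≤ endDist b (q w).2} := isClosed_le hp2 hq2
  refine ⟨?_, hedge.isOpen.inter hlt⟩
  convert hedge.isClosed.inter hle using 1
  ext w
  refine and_congr_right fun hw => ⟨le_of_lt, fun hle => hle.lt_of_ne fun heq => hpq w ?_⟩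
  exact Prod.ext hw (endDist_injective b heq.symm)

theorem continuous_ite_of_isClopen {X Y : Type*} [TopologicalSpace X] [TopologicalSpace Y]
    {P : X → Prop} [DecidablePred P] (hP : IsClopen {x | P x}) {f g : X → Y} (hf : Continuous f)
    (hg : Continuous g) : Continuous fun x => if P x then f x else g x :=
  continuous_if (by simp [show frontier {x | P x} = ∅ from hP.frontier_eq]) hf.continuousOn
    hg.continuousOn

open Classical in
/-- Seen from the end `b` of the edge of `p`, the distance to the first token beyond `p`, or `1`
(the length of the edge) if there is none. Which tokens are beyond `p` is decided by their positions
`y`, while the distance is that of their positions `t`: in this way a position between the tokens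
`y` can be compared with the corresponding position between the tokens `t`. -/
noncomputable def nextDist (b : Bool) (y t : Fin n → E × unitInterval) (p : E × unitInterval) :
    unitInterval :=
  Finset.univ.inf fun j =>
    if (y j).1 = p.1 ∧ endDist b p.2 < endDist b (y j).2 then endDist b (t j).2 else 1

section NextDist

variable {b : Bool} {y y' t t' : Fin n → E × unitInterval} {p : E × unitInterval}

theorem nextDist_le {j : Fin n} (h : (y j).1 = p.1) (h' : endDist b p.2 < endDist b (y j).2) :
    nextDist b y t p ≤ endDist b (t j).2 := by
  refine (Finset.inf_le (Finset.mem_univ j)).trans ?_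
  rw [if_pos ⟨h, h'⟩]

theorem le_nextDist {s : unitInterval}
    (h : ∀ j, (y j).1 = p.1 → endDist b p.2 < endDist b (y j).2 → s ≤ endDist b (t j).2) :
    s ≤ nextDist b y t p := by
  refine Finset.le_inf fun j _ => ?_
  split_ifs with hj
  · exact h j hj.1 hj.2
  · exact unitInterval.le_one'

theorem lt_nextDist {s : unitInterval} (hs : s < 1)
    (h : ∀ j, (y j).1 = p.1 → endDist b p.2 < endDist b (y j).2 → s < endDist b (t j).2) :
    s < nextDist b y t p := by
  classical
  refine (Finset.lt_inf_iff hs).2 fun j _ => ?_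
  split_ifs with hj
  · exact h j hj.1 hj.2
  · exact hs

theorem nextDist_eq_one (h : ∀ j, (y j).1 = p.1 → endDist b (y j).2 ≤ endDist b p.2) :
    nextDist b y t p = 1 :=
  le_antisymm unitInterval.le_one' (le_nextDist fun j h1 h2 => absurd h2 (not_lt.2 (h j h1)))

theorem nextDist_congr (h : ∀ j, (y j = y' j ∧ t j = t' j) ∨
      ∃ o o', y j = endOf o ∧ t j = endOf o ∧ y' j = endOf o' ∧ t' j = endOf o') :
    nextDist b y t p = nextDist b y' t' p := by
  have hend {y t : Fin n → E × unitInterval} {j : Fin n} {o : E × Bool} (hy : y j = endOf o)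
      (ht : t j = endOf o) :
      (y j).1 = p.1 ∧ endDist b p.2 < endDist b (y j).2 → endDist b (t j).2 = 1 := by
    rintro ⟨-, hlt⟩
    rw [hy] at hlt
    rw [ht]
    exact (endDist_endOf_eq_zero_or_one b o).resolve_left (ne_bot_of_gt hlt)
  classical
  refine Finset.inf_congr rfl fun j _ => ?_
  rcases h j with ⟨h1, h2⟩ | ⟨o, o', h1, h2, h3, h4⟩
  · rw [h1, h2]
  · rw [ite_eq_right_iff.2 (hend h1 h2), ite_eq_right_iff.2 (hend h3 h4)]

theorem continuous_nextDist [TopologicalSpace E] [DiscreteTopology E] {W : Type*}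
    [TopologicalSpace W] (b : Bool) {y t : W → Fin n → E × unitInterval} {p : W → E × unitInterval}
    (hy : Continuous y) (ht : Continuous t) (hp : Continuous p)
    (hyp : ∀ j, (∀ w, y w j = p w) ∨ ∀ w, y w j ≠ p w) :
    Continuous fun w => nextDist b (y w) (t w) (p w) := by
  classical
  refine Continuous.finset_inf_apply fun j _ => ?_
  rcases hyp j with heq | hne
  · simp [heq, continuous_const]
  · exact continuous_ite_of_isClopen
      (isClopen_endDist_lt_endDist hp ((continuous_apply j).comp hy) hne b)
      ((continuous_endDist b).comp (continuous_snd.comp ((continuous_apply j).comp ht)))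
      continuous_const

theorem endDist_le_nextDist_self : endDist b p.2 ≤ nextDist b y y p :=
  le_nextDist fun _ _ hj => hj.le

theorem endDist_lt_nextDist_self (h : endDist b p.2 < 1) : endDist b p.2 < nextDist b y y p :=
  lt_nextDist h fun _ _ hj => hj

theorem symm_nextDist_self_le (y : Fin n → E × unitInterval)
    (p : E × unitInterval) :
    unitInterval.symm (nextDist true y y p) ≤ p.2 :=
  unitInterval.symm_le_comm.1 (endDist_le_nextDist_self (b := true))

theorem symm_nextDist_self_lt (y : Fin n → E × unitInterval) {p : E × unitInterval}
    (hp : 0 < p.2) : unitInterval.symm (nextDist true y y p) < p.2 :=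
  unitInterval.symm_lt_comm.1 (endDist_lt_nextDist_self (b := true)
    (unitInterval.symm_lt_comm.1 (unitInterval.symm_one.trans_lt hp)))

theorem symm_nextDist_self_lt_nextDist_self (y : Fin n → E × unitInterval)
    (p : E × unitInterval) :
    (unitInterval.symm (nextDist true y y p) : ℝ) < nextDist false y y p := by
  refine Subtype.coe_lt_coe.2 ?_
  have hle : p.2 ≤ nextDist false y y p := endDist_le_nextDist_self (b := false)
  rcases eq_or_lt_of_le (show 0 ≤ p.2 from unitInterval.nonneg') with h | h
  · exact (symm_nextDist_self_le y p).trans_lt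
      (endDist_lt_nextDist_self (b := false) (h.symm.trans_lt zero_lt_one))
  · exact (symm_nextDist_self_lt y h).trans_le hle

end NextDist

/-! ### Arrangements of tokens on edges -/

/-- A distribution of the tokens `0, …, n - 1` to the edges, together with their order along each
edge. -/
@[ext]
structure Arrangement (E : Type*) (n : ℕ) where
  edge : Fin n → E
  count : E → ℕ
  rank : Fin n → ℕ
  bijOn_rank : ∀ e, BijOn rank {i | edge i = e} (Iio (count e))

namespace Arrangement

variable (A : Arrangement E n)

theorem rank_lt_count (i : Fin n) : A.rank i < A.count (A.edge i) := (A.bijOn_rank _).mapsTo rfl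

theorem ncard_rank_lt {e : E} {k : ℕ} (hk : k ≤ A.count e) :
    {i | A.edge i = e ∧ A.rank i < k}.ncard = k :=
  ((A.bijOn_rank e).subset_right (Iio_subset_Iio hk)).ncard_eq.trans (ncard_Iio_nat k)

theorem ncard_edge_eq (e : E) : {i | A.edge i = e}.ncard = A.count e := by
  rw [← A.ncard_rank_lt le_rfl]
  congr 1
  ext i
  exact ⟨fun h => ⟨h, (A.bijOn_rank e).mapsTo h⟩, And.left⟩

theorem ext_of_rank_lt_iff {A B : Arrangement E n} (hedge : A.edge = B.edge)
    (hrank : ∀ i j, A.edge i = A.edge j → (A.rank i < A.rank j ↔ B.rank i < B.rank j)) : A = B := by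
  refine Arrangement.ext hedge (funext fun e => ?_) (funext fun i => ?_)
  · rw [← A.ncard_edge_eq, ← B.ncard_edge_eq, hedge]
  · rw [← A.ncard_rank_lt (A.rank_lt_count i).le, ← B.ncard_rank_lt (B.rank_lt_count i).le]
    congr 1
    ext j
    rw [mem_ofPred_eq, mem_ofPred_eq, hedge]
    exact and_congr_right fun h => hrank j i (by rw [hedge, h])

/-- The rank of a token counted from the end `1` (for `true`) or `0` (for `false`) of its edge. -/
def rankFrom (b : Bool) (i : Fin n) : ℕ :=
  if b then A.count (A.edge i) - 1 - A.rank i else A.rank i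

theorem rankFrom_not_add_rankFrom_add_one (b : Bool) (i : Fin n) :
    A.rankFrom (!b) i + A.rankFrom b i + 1 = A.count (A.edge i) := by
  have := A.rank_lt_count i
  cases b <;> simp [rankFrom] <;> omega

theorem bijOn_rankFrom (b : Bool) (e : E) :
    BijOn (A.rankFrom b) {i | A.edge i = e} (Iio (A.count e)) := by
  cases b
  · exact A.bijOn_rank e
  · have hreflect : BijOn (fun k => A.count e - 1 - k) (Iio (A.count e)) (Iio (A.count e)) := by
      refine ⟨fun k hk => ?_, fun k hk l hl hkl => ?_, fun k hk => ⟨A.count e - 1 - k, ?_, ?_⟩⟩ <;>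
        simp only [mem_Iio] at * <;> omega
    refine (hreflect.comp (A.bijOn_rank e)).congr fun i hi => ?_
    rw [mem_ofPred_eq] at hi
    simp [rankFrom, hi]

/-- The length of an edge in units of the spacing of its tokens, when `γ` is the length of the gaps
at the ends of the edges in these units. -/
def units (γ : E × Bool → ℝ) (e : E) : ℝ := γ (e, false) + γ (e, true) + A.count e - 1

/-- Evenly spaced tokens, except for the prescribed gaps `γ` at the ends of the edges. -/
noncomputable def place (γ : E × Bool → ℝ) (i : Fin n) : E × unitInterval :=
  (A.edge i, projIcc 0 1 zero_le_one ((γ (A.edge i, false) + A.rank i) / A.units γ (A.edge i)))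

end Arrangement

/-- The sizes of the gaps at the ends of the edges that occur in the cube complex, in units of the
spacing of the tokens. A gap smaller than `1` stands for a moving token, a gap `0` for a token that
has arrived at the vertex. -/
structure IsGapFunction (G : CellGraph V E) (A : Arrangement E n) (γ : G.OrientedEdge → ℝ) :
    Prop where
  nonneg : ∀ o, 0 ≤ γ o
  le_one : ∀ o, γ o ≤ 1
  branched : ∀ o, γ o < 1 → G.IsBranched (G.head o)
  unique : ∀ o o', γ o < 1 → γ o' < 1 → G.head o = G.head o' → o = o'
  count_pos : ∀ o, γ o < 1 → 0 < A.count o.1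
  two_le : ∀ e, γ (e, false) < 1 → γ (e, true) < 1 → 2 ≤ A.count e

namespace IsGapFunction

open Arrangement

variable {A : Arrangement E n} {γ : G.OrientedEdge → ℝ}

theorem one_le_units (h : IsGapFunction G A γ) (e : E) : 1 ≤ A.units γ e := by
  have h0 := h.nonneg (e, false)
  have h1 := h.nonneg (e, true)
  unfold units
  rcases (h.le_one (e, false)).lt_or_eq with h0' | h0' <;>
  rcases (h.le_one (e, true)).lt_or_eq with h1' | h1'
  · have : (2 : ℝ) ≤ A.count e := by exact_mod_cast h.two_le e h0' h1'
    linarith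
  · have : (1 : ℝ) ≤ A.count e := by exact_mod_cast h.count_pos _ h0'
    linarith
  · have : (1 : ℝ) ≤ A.count e := by exact_mod_cast h.count_pos _ h1'
    linarith
  · have : (0 : ℝ) ≤ A.count e := Nat.cast_nonneg _
    linarith

theorem units_pos (h : IsGapFunction G A γ) (e : E) : 0 < A.units γ e :=
  zero_lt_one.trans_le (h.one_le_units e)

theorem endDist_place (h : IsGapFunction G A γ) (b : Bool) (i : Fin n) :
    (endDist b (A.place γ i).2 : ℝ) =
      (γ (A.edge i, b) + A.rankFrom b i) / A.units γ (A.edge i) := by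
  have hunits := h.units_pos (A.edge i)
  have h0 := h.nonneg (A.edge i, false)
  have h1 := h.nonneg (A.edge i, true)
  have hcount : ((A.rankFrom true i : ℕ) : ℝ) + A.rank i + 1 = A.count (A.edge i) := by
    exact_mod_cast A.rankFrom_not_add_rankFrom_add_one false i
  have hmem : (γ (A.edge i, false) + A.rank i) / A.units γ (A.edge i) ∈ Icc (0 : ℝ) 1 := by
    refine ⟨by positivity, (div_le_one hunits).2 ?_⟩
    unfold units
    linarith
  have hplace : ((A.place γ i).2 : ℝ) =
      (γ (A.edge i, false) + A.rank i) / A.units γ (A.edge i) := by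
    rw [place, projIcc_of_mem _ hmem]
  cases b
  · exact hplace
  · simp only [endDist, if_true, unitInterval.coe_symm_eq, hplace]
    rw [eq_div_iff hunits.ne', sub_mul, div_mul_cancel₀ _ hunits.ne', units]
    linarith

theorem endDist_place_lt_endDist_place (h : IsGapFunction G A γ) (b : Bool) {i j : Fin n}
    (hij : A.edge i = A.edge j) :
    endDist b (A.place γ i).2 < endDist b (A.place γ j).2 ↔ A.rankFrom b i < A.rankFrom b j := by
  rw [← Subtype.coe_lt_coe, h.endDist_place, h.endDist_place, hij,
    div_lt_div_iff_of_pos_right (h.units_pos _)]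
  simp

theorem place_eq_endOf_iff (h : IsGapFunction G A γ) {i : Fin n} {o : E × Bool} :
    A.place γ i = endOf o ↔ A.edge i = o.1 ∧ γ o = 0 ∧ A.rankFrom o.2 i = 0 := by
  obtain ⟨e, b⟩ := o
  have hdist : A.edge i = e → (endDist b (A.place γ i).2 = 0 ↔ γ (e, b) = 0 ∧
      A.rankFrom b i = 0) := by
    rintro rfl
    rw [← Subtype.coe_inj, h.endDist_place, Icc.coe_zero, div_eq_zero_iff,
      or_iff_left (h.units_pos _).ne', add_eq_zero_iff_of_nonneg (h.nonneg _) (Nat.cast_nonneg _),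
      Nat.cast_eq_zero]
  constructor
  · intro hi
    have hedge : A.edge i = e := congrArg Prod.fst hi
    exact ⟨hedge, (hdist hedge).1 (by rw [hi, endDist_endOf (e, b)])⟩
  · rintro ⟨hedge, hi⟩
    exact eq_endOf_of_endDist_eq_zero (o := (e, b)) hedge ((hdist hedge).2 hi)

theorem chart_place_injective (h : IsGapFunction G A γ) :
    Function.Injective (G.chart ∘ A.place γ) := by
  intro i j hij
  rcases eq_or_endOf_of_chart_eq hij with hp | ⟨o, o', hi, hj, ho⟩
  · have hedge : A.edge i = A.edge j := congrArg Prod.fst hp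
    refine (A.bijOn_rank _).injOn hedge rfl (le_antisymm ?_ ?_)
    · exact not_lt.1 (mt (h.endDist_place_lt_endDist_place false hedge.symm).2 (by simp [hp]))
    · exact not_lt.1 (mt (h.endDist_place_lt_endDist_place false hedge).2 (by simp [hp]))
  · obtain ⟨hi, hio, hri⟩ := h.place_eq_endOf_iff.1 hi
    obtain ⟨hj, hjo, hrj⟩ := h.place_eq_endOf_iff.1 hj
    obtain rfl := h.unique o o' (by linarith) (by linarith) ho
    exact (A.bijOn_rankFrom o.2 o.1).injOn hi hj (hri.trans hrj.symm)

/-- The lifted configuration with given arrangement and gaps. -/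
noncomputable def lift (h : IsGapFunction G A γ) : G.Lift n := ⟨A.place γ, h.chart_place_injective⟩

end IsGapFunction

namespace Lift

variable (z : G.Lift n)

theorem injective : Function.Injective z.1 := z.2.of_comp

theorem eq_of_endOf {i j : Fin n} {o o' : G.OrientedEdge} (hi : z.1 i = endOf o)
    (hj : z.1 j = endOf o') (h : G.head o = G.head o') : o = o' := by
  obtain rfl : i = j := z.2 (by simp [hi, hj, chart_endOf, h])
  exact endOf_injective (hi.symm.trans hj)

/-- The number of tokens on an edge. -/
noncomputable def tokenCount (e : E) : ℕ := {j | (z.1 j).1 = e}.ncard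

/-- The number of tokens on the same edge with a smaller coordinate. -/
noncomputable def tokenRank (i : Fin n) : ℕ :=
  {j | (z.1 j).1 = (z.1 i).1 ∧ (z.1 j).2 < (z.1 i).2}.ncard

theorem tokenRank_lt_tokenCount (i : Fin n) : z.tokenRank i < z.tokenCount (z.1 i).1 :=
  ncard_lt_ncard ⟨fun _ => And.left, fun h => (h (rfl : (z.1 i).1 = (z.1 i).1)).2.false⟩

theorem tokenRank_lt_tokenRank {i j : Fin n} (hij : (z.1 i).1 = (z.1 j).1)
    (h : (z.1 i).2 < (z.1 j).2) : z.tokenRank i < z.tokenRank j :=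
  ncard_lt_ncard ⟨fun _ hk => ⟨hk.1.trans hij, hk.2.trans h⟩,
    fun hsub => (hsub (⟨hij, h⟩ : (z.1 i).1 = (z.1 j).1 ∧ (z.1 i).2 < (z.1 j).2)).2.false⟩

theorem tokenRank_lt_tokenRank_iff {i j : Fin n} (hij : (z.1 i).1 = (z.1 j).1) :
    z.tokenRank i < z.tokenRank j ↔ (z.1 i).2 < (z.1 j).2 := by
  refine ⟨fun h => ?_, z.tokenRank_lt_tokenRank hij⟩
  rcases lt_trichotomy (z.1 i).2 (z.1 j).2 with hlt | heq | hgt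
  · exact hlt
  · rw [z.injective (Prod.ext hij heq)] at h
    exact h.false.elim
  · exact absurd (z.tokenRank_lt_tokenRank hij.symm hgt) h.not_gt

theorem bijOn_tokenRank (e : E) : BijOn z.tokenRank {i | (z.1 i).1 = e} (Iio (z.tokenCount e)) := by
  have hmaps : MapsTo z.tokenRank {i | (z.1 i).1 = e} (Iio (z.tokenCount e)) := by
    rintro i rfl
    exact z.tokenRank_lt_tokenCount i
  have hinj : InjOn z.tokenRank {i | (z.1 i).1 = e} := by
    intro i hi j hj hij
    have hij' : (z.1 i).1 = (z.1 j).1 := hi.trans hj.symm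
    refine z.injective (Prod.ext hij' (le_antisymm ?_ ?_))
    · exact not_lt.1 (mt (z.tokenRank_lt_tokenRank hij'.symm) hij.not_gt)
    · exact not_lt.1 (mt (z.tokenRank_lt_tokenRank hij') hij.not_lt)
  refine ⟨hmaps, hinj, ?_⟩
  have himage : z.tokenRank '' {i | (z.1 i).1 = e} = Iio (z.tokenCount e) := by
    refine eq_of_subset_of_ncard_le hmaps.image_subset ?_ (finite_Iio _)
    rw [hinj.ncard_image, ncard_Iio_nat, tokenCount]
  exact himage.symm.subset

/-- The arrangement of the tokens of a lifted configuration. -/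
noncomputable def arrangement : Arrangement E n where
  edge i := (z.1 i).1
  count := z.tokenCount
  rank := z.tokenRank
  bijOn_rank := z.bijOn_tokenRank

theorem rankFrom_lt_rankFrom_iff (b : Bool) {i j : Fin n} (hij : (z.1 i).1 = (z.1 j).1) :
    z.arrangement.rankFrom b i < z.arrangement.rankFrom b j ↔
      endDist b (z.1 i).2 < endDist b (z.1 j).2 := by
  have hfalse {i j : Fin n} (hij : (z.1 i).1 = (z.1 j).1) :
      z.arrangement.rankFrom false i < z.arrangement.rankFrom false j ↔ (z.1 i).2 < (z.1 j).2 :=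
    z.tokenRank_lt_tokenRank_iff hij
  cases b
  · exact hfalse hij
  · have hi := z.arrangement.rankFrom_not_add_rankFrom_add_one false i
    have hj := z.arrangement.rankFrom_not_add_rankFrom_add_one false j
    rw [show z.arrangement.edge i = z.arrangement.edge j from hij] at hi
    refine Iff.trans ?_ ((hfalse hij.symm).trans unitInterval.symm_lt_symm.symm)
    rw [Bool.not_false] at hi hj
    omega

theorem rankFrom_eq_zero_iff (b : Bool) {i : Fin n} : z.arrangement.rankFrom b i = 0 ↔
    ∀ j, (z.1 j).1 = (z.1 i).1 → endDist b (z.1 i).2 ≤ endDist b (z.1 j).2 := by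
  constructor
  · intro hzero j hj
    rw [← not_lt, ← z.rankFrom_lt_rankFrom_iff b hj, hzero]
    exact Nat.not_lt_zero _
  · intro hle
    have hadd := z.arrangement.rankFrom_not_add_rankFrom_add_one b i
    obtain ⟨j, hj, hrank⟩ := (z.arrangement.bijOn_rankFrom b (z.1 i).1).surjOn
      (show 0 < z.arrangement.count (z.arrangement.edge i) by omega)
    have hnot := mt (z.rankFrom_lt_rankFrom_iff b hj).1 (hle j hj).not_gt
    omega

theorem rankFrom_eq_zero_of_eq_endOf {i : Fin n} {o : G.OrientedEdge} (hi : z.1 i = endOf o) :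
    z.arrangement.rankFrom o.2 i = 0 := by
  refine (z.rankFrom_eq_zero_iff o.2).2 fun j _ => ?_
  rw [hi, endDist_endOf]
  exact unitInterval.nonneg'

/-- The distance of a token from an end of its edge relative to the gap behind the token,
truncated at `1`. -/
noncomputable def ratio (b : Bool) (i : Fin n) : ℝ :=
  endDist b (z.1 i).2 /
    max (endDist b (z.1 i).2 : ℝ) (nextDist b z.1 z.1 (z.1 i) - endDist b (z.1 i).2)

open Classical in
/-- A measure of how close the tokens on the edge of `o` are to the head of `o`: it is `0` if and
only if one of them is there. -/
noncomputable def depth (o : G.OrientedEdge) : ℝ := ∏ i with (z.1 i).1 = o.1, z.ratio o.2 i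

open Classical in
/-- A measure of how close the tokens on the other oriented edges with the same head are. -/
noncomputable def others [Fintype E] (o : G.OrientedEdge) : ℝ :=
  ∏ o' with G.head o' = G.head o ∧ o' ≠ o, z.depth o'

open Classical in
/-- The gap that is left between the head of `o` and the nearest token on the edge of `o`, in units
of the spacing on that edge, when the configuration is retracted to the cube complex. -/
noncomputable def gap [Fintype E] (o : G.OrientedEdge) : ℝ :=
  if G.IsBranched (G.head o) then z.depth o / max (z.depth o) (z.others o) else 1

theorem ratio_nonneg (b : Bool) (i : Fin n) : 0 ≤ z.ratio b i :=
  div_nonneg unitInterval.nonneg' (le_max_of_le_left unitInterval.nonneg')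

theorem ratio_le_one (b : Bool) (i : Fin n) : z.ratio b i ≤ 1 :=
  div_le_one_of_le₀ (le_max_left _ _) (le_max_of_le_left unitInterval.nonneg')

theorem ratio_eq_zero_iff (b : Bool) (i : Fin n) :
    z.ratio b i = 0 ↔ endDist b (z.1 i).2 = 0 := by
  constructor
  · intro h
    by_contra hne
    have hpos : (0 : ℝ) < endDist b (z.1 i).2 := unitInterval.pos_iff_ne_zero.2 hne
    exact (div_pos hpos (lt_max_of_lt_left hpos)).ne' h
  · intro h
    simp [ratio, h]

theorem endDist_lt_half_of_ratio_lt_one {b : Bool} {i : Fin n} (h : z.ratio b i < 1) :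
    (endDist b (z.1 i).2 : ℝ) < 1 / 2 := by
  by_contra! hhalf
  have hnext : (nextDist b z.1 z.1 (z.1 i) : ℝ) ≤ 1 := unitInterval.le_one'
  rw [ratio, max_eq_left (by linarith), div_self (by linarith)] at h
  exact h.false

theorem depth_nonneg (o : G.OrientedEdge) : 0 ≤ z.depth o :=
  Finset.prod_nonneg fun i _ => z.ratio_nonneg o.2 i

theorem depth_le_one (o : G.OrientedEdge) : z.depth o ≤ 1 :=
  Finset.prod_le_one (fun i _ => z.ratio_nonneg o.2 i) fun i _ => z.ratio_le_one o.2 i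

theorem depth_eq_zero_iff (o : G.OrientedEdge) : z.depth o = 0 ↔ ∃ i, z.1 i = endOf o := by
  simp only [depth, Finset.prod_eq_zero_iff, Finset.mem_filter_univ, ratio_eq_zero_iff]
  refine exists_congr fun i => ⟨fun h => eq_endOf_of_endDist_eq_zero h.1 h.2, fun h => ?_⟩
  rw [h]
  exact ⟨rfl, endDist_endOf o⟩

theorem exists_endDist_lt_half {o : G.OrientedEdge} (h : z.depth o < 1) :
    ∃ i, (z.1 i).1 = o.1 ∧ (endDist o.2 (z.1 i).2 : ℝ) < 1 / 2 := by
  by_contra! hge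
  classical
  refine h.ne (Finset.prod_eq_one fun i hi => ?_)
  refine le_antisymm (z.ratio_le_one o.2 i) (not_lt.1 fun hlt => ?_)
  exact (z.endDist_lt_half_of_ratio_lt_one hlt).not_ge (hge i ((Finset.mem_filter_univ i).1 hi))

section Fintype

variable [Fintype E]

theorem others_nonneg (o : G.OrientedEdge) : 0 ≤ z.others o :=
  Finset.prod_nonneg fun o' _ => z.depth_nonneg o'

theorem others_le_one (o : G.OrientedEdge) : z.others o ≤ 1 :=
  Finset.prod_le_one (fun o' _ => z.depth_nonneg o') fun o' _ => z.depth_le_one o'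

theorem others_le_depth {o o' : G.OrientedEdge} (h : G.head o' = G.head o) (h' : o' ≠ o) :
    z.others o ≤ z.depth o' := by
  classical
  rw [others, ← Finset.mul_prod_erase _ _ ((Finset.mem_filter_univ o').2 ⟨h, h'⟩)]
  exact mul_le_of_le_one_right (z.depth_nonneg o')
    (Finset.prod_le_one (fun p _ => z.depth_nonneg p) fun p _ => z.depth_le_one p)

theorem max_depth_others_pos (o : G.OrientedEdge) : 0 < max (z.depth o) (z.others o) := by
  by_contra! hle
  classical
  have hdepth : z.depth o = 0 := le_antisymm ((le_max_left _ _).trans hle) (z.depth_nonneg o)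
  have hothers : z.others o = 0 := le_antisymm ((le_max_right _ _).trans hle) (z.others_nonneg o)
  obtain ⟨i, hi⟩ := (z.depth_eq_zero_iff o).1 hdepth
  obtain ⟨o', ho', hdepth'⟩ := Finset.prod_eq_zero_iff.1 hothers
  obtain ⟨hhead, hne⟩ := (Finset.mem_filter_univ o').1 ho'
  obtain ⟨j, hj⟩ := (z.depth_eq_zero_iff o').1 hdepth'
  exact hne (z.eq_of_endOf hj hi hhead)

theorem gap_nonneg (o : G.OrientedEdge) : 0 ≤ z.gap o := by
  unfold gap
  split_ifs
  · exact div_nonneg (z.depth_nonneg o) (z.max_depth_others_pos o).le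
  · exact zero_le_one

theorem gap_le_one (o : G.OrientedEdge) : z.gap o ≤ 1 := by
  unfold gap
  split_ifs
  · exact (div_le_one (z.max_depth_others_pos o)).2 (le_max_left _ _)
  · exact le_rfl

theorem isBranched_and_depth_lt_others {o : G.OrientedEdge} (h : z.gap o < 1) :
    G.IsBranched (G.head o) ∧ z.depth o < z.others o := by
  unfold gap at h
  split_ifs at h with hb
  · rw [div_lt_one (z.max_depth_others_pos o)] at h
    exact ⟨hb, (lt_max_iff.1 h).resolve_left (lt_irrefl _)⟩
  · exact absurd h (lt_irrefl _)

theorem gap_eq_zero_iff {o : G.OrientedEdge} (hb : G.IsBranched (G.head o)) :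
    z.gap o = 0 ↔ ∃ i, z.1 i = endOf o := by
  rw [gap, if_pos hb, div_eq_zero_iff, or_iff_left (z.max_depth_others_pos o).ne',
    depth_eq_zero_iff]

theorem isGapFunction_gap : IsGapFunction G z.arrangement z.gap := by
  have hhalf {o : G.OrientedEdge} (h : z.gap o < 1) :
      ∃ i, (z.1 i).1 = o.1 ∧ (endDist o.2 (z.1 i).2 : ℝ) < 1 / 2 :=
    z.exists_endDist_lt_half ((z.isBranched_and_depth_lt_others h).2.trans_le (z.others_le_one o))
  refine ⟨z.gap_nonneg, z.gap_le_one, fun o h => (z.isBranched_and_depth_lt_others h).1,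
    fun o o' h h' ho => ?_, fun o h => ?_, fun e h h' => ?_⟩
  · by_contra hne
    have hlt := (z.isBranched_and_depth_lt_others h).2.trans_le
      (z.others_le_depth ho.symm (Ne.symm hne))
    have hlt' := (z.isBranched_and_depth_lt_others h').2.trans_le (z.others_le_depth ho hne)
    exact lt_asymm hlt hlt'
  · obtain ⟨i, hi, -⟩ := hhalf h
    exact (Nat.zero_le _).trans_lt (hi ▸ z.tokenRank_lt_tokenCount i)
  · obtain ⟨i, rfl, hi⟩ := hhalf h
    obtain ⟨j, hj, hj'⟩ := hhalf h'
    have hne : i ≠ j := by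
      rintro rfl
      have := coe_endDist_not false (z.1 i).2
      rw [Bool.not_false] at this
      linarith
    exact (one_lt_ncard (toFinite _)).2 ⟨i, rfl, j, hj, hne⟩

/-- The retraction to the cube complex in edge coordinates: the tokens are spread evenly along their
edges, except for the gaps at the ends of the edges. -/
noncomputable def spread : G.Lift n := z.isGapFunction_gap.lift

theorem endDist_spread_lt_endDist_spread (b : Bool) {i j : Fin n} (hij : (z.1 i).1 = (z.1 j).1) :
    endDist b (z.spread.1 i).2 < endDist b (z.spread.1 j).2 ↔
      endDist b (z.1 i).2 < endDist b (z.1 j).2 :=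
  (z.isGapFunction_gap.endDist_place_lt_endDist_place b hij).trans
    (z.rankFrom_lt_rankFrom_iff b hij)

theorem spread_eq_endOf_iff {i : Fin n} {o : G.OrientedEdge} :
    z.spread.1 i = endOf o ↔ G.IsBranched (G.head o) ∧ z.1 i = endOf o := by
  refine z.isGapFunction_gap.place_eq_endOf_iff.trans ⟨?_, ?_⟩
  · rintro ⟨hedge, hgap, hrank⟩
    have hb : G.IsBranched (G.head o) := z.isGapFunction_gap.branched o (hgap ▸ zero_lt_one)
    obtain ⟨j, hj⟩ := (z.gap_eq_zero_iff hb).1 hgap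
    obtain rfl : i = j := (z.arrangement.bijOn_rankFrom o.2 o.1).injOn hedge
      (congrArg Prod.fst hj) (hrank.trans (z.rankFrom_eq_zero_of_eq_endOf hj).symm)
    exact ⟨hb, hj⟩
  · rintro ⟨hb, hi⟩
    exact ⟨congrArg Prod.fst hi, (z.gap_eq_zero_iff hb).2 ⟨i, hi⟩,
      z.rankFrom_eq_zero_of_eq_endOf hi⟩

end Fintype

end Lift

/-! ### Evenly spread configurations are fixed -/

namespace IsGapFunction

open Arrangement

variable {A : Arrangement E n} {γ : G.OrientedEdge → ℝ}

theorem arrangement_lift (h : IsGapFunction G A γ) : h.lift.arrangement = A :=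
  ext_of_rank_lt_iff rfl fun _ _ hij =>
    (h.lift.tokenRank_lt_tokenRank_iff hij).trans (h.endDist_place_lt_endDist_place false hij)

theorem nextDist_place_of_rankFrom_not_eq_zero (h : IsGapFunction G A γ) {b : Bool} {i : Fin n}
    (hi : A.rankFrom (!b) i = 0) : nextDist b (A.place γ) (A.place γ) (A.place γ i) = 1 := by
  refine nextDist_eq_one fun j hj => not_lt.1 fun hlt => ?_
  have := (h.endDist_place_lt_endDist_place (!b) hj).1 (endDist_not_lt_endDist_not.2 hlt)
  omega

theorem nextDist_place_of_rankFrom_eq_add_one (h : IsGapFunction G A γ) {b : Bool} {i j : Fin n}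
    (hij : A.edge j = A.edge i) (hrank : A.rankFrom b j = A.rankFrom b i + 1) :
    nextDist b (A.place γ) (A.place γ) (A.place γ i) = endDist b (A.place γ j).2 := by
  refine le_antisymm (nextDist_le hij ?_) (le_nextDist fun k hk hik => not_lt.1 fun hkj => ?_)
  · exact (h.endDist_place_lt_endDist_place b hij.symm).2 (by omega)
  · have hk : A.edge k = A.edge i := hk
    have := (h.endDist_place_lt_endDist_place b hk.symm).1 hik
    have := (h.endDist_place_lt_endDist_place b (hk.trans hij.symm)).1 hkj
    omega

open Classical in
theorem nextDist_place_sub_endDist_place (h : IsGapFunction G A γ) (b : Bool) (i : Fin n) :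
    (nextDist b (A.place γ) (A.place γ) (A.place γ i) : ℝ) - endDist b (A.place γ i).2 =
      (if A.rankFrom (!b) i = 0 then γ (A.edge i, !b) else 1) / A.units γ (A.edge i) := by
  split_ifs with hlast
  · rw [h.nextDist_place_of_rankFrom_not_eq_zero hlast, Icc.coe_one, ← coe_endDist_not,
      h.endDist_place, hlast, Nat.cast_zero, add_zero]
  · have hadd := A.rankFrom_not_add_rankFrom_add_one b i
    obtain ⟨j, hj, hrank⟩ := (A.bijOn_rankFrom b (A.edge i)).surjOn
      (show A.rankFrom b i + 1 < A.count (A.edge i) by omega)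
    rw [h.nextDist_place_of_rankFrom_eq_add_one hj hrank, h.endDist_place, h.endDist_place,
      show A.edge j = A.edge i from hj, hrank, ← sub_div, Nat.cast_add_one]
    ring

open Classical in
theorem ratio_lift (h : IsGapFunction G A γ) (b : Bool) (i : Fin n) :
    h.lift.ratio b i = (γ (A.edge i, b) + A.rankFrom b i) / max (γ (A.edge i, b) + A.rankFrom b i)
      (if A.rankFrom (!b) i = 0 then γ (A.edge i, !b) else 1) := by
  have hunits := h.units_pos (A.edge i)
  change (endDist b (A.place γ i).2 : ℝ) / max (endDist b (A.place γ i).2 : ℝ)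
    ((nextDist b (A.place γ) (A.place γ) (A.place γ i) : ℝ) - endDist b (A.place γ i).2) = _
  rw [h.nextDist_place_sub_endDist_place, h.endDist_place, max_div_div_right hunits.le,
    div_div_div_cancel_right₀ hunits.ne']

theorem ratio_lift_of_ne_zero (h : IsGapFunction G A γ) {b : Bool} {i : Fin n}
    (hi : A.rankFrom b i ≠ 0) : h.lift.ratio b i = 1 := by
  have hrank : (1 : ℝ) ≤ A.rankFrom b i := by exact_mod_cast Nat.one_le_iff_ne_zero.2 hi
  have hnonneg := h.nonneg (A.edge i, b)
  rw [ratio_lift, max_eq_left, div_self (by linarith)]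
  split_ifs <;> linarith [h.le_one (A.edge i, !b)]

theorem ratio_lift_of_eq_zero (h : IsGapFunction G A γ) {b : Bool} {i : Fin n}
    (hi : A.rankFrom b i = 0) : h.lift.ratio b i = γ (A.edge i, b) := by
  rw [ratio_lift, hi, Nat.cast_zero, add_zero]
  split_ifs with hlast
  · rcases (h.le_one (A.edge i, b)).lt_or_eq with hlt | heq
    · suffices heq' : γ (A.edge i, !b) = 1 by rw [heq', max_eq_right hlt.le, div_one]
      by_contra hne
      have hlt' := (h.le_one (A.edge i, !b)).lt_of_ne hne
      have hcount : 2 ≤ A.count (A.edge i) := by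
        cases b
        · exact h.two_le _ hlt hlt'
        · exact h.two_le _ hlt' hlt
      have := A.rankFrom_not_add_rankFrom_add_one b i
      omega
    · rw [heq, max_eq_left (h.le_one _), div_one]
  · rw [max_eq_right (h.le_one _), div_one]

theorem depth_lift (h : IsGapFunction G A γ) (o : G.OrientedEdge) : h.lift.depth o = γ o := by
  classical
  obtain ⟨e, b⟩ := o
  rcases (A.count e).eq_zero_or_pos with hcount | hcount
  · have hone : γ (e, b) = 1 :=
      (h.le_one _).eq_of_not_lt fun hlt => (h.count_pos _ hlt).ne' hcount
    rw [hone]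
    refine Finset.prod_eq_one fun i hi => ?_
    have hlt := A.rank_lt_count i
    rw [show A.edge i = e from (Finset.mem_filter_univ i).1 hi, hcount] at hlt
    exact absurd hlt (Nat.not_lt_zero _)
  · obtain ⟨i, rfl, hrank⟩ := (A.bijOn_rankFrom b e).surjOn hcount
    have hi : i ∈ Finset.univ.filter fun j => (h.lift.1 j).1 = A.edge i :=
      (Finset.mem_filter_univ i).2 rfl
    refine (Finset.prod_eq_single_of_mem i hi fun j hj hji => ?_).trans
      (h.ratio_lift_of_eq_zero hrank)
    refine h.ratio_lift_of_ne_zero fun hj' => hji ?_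
    exact (A.bijOn_rankFrom b (A.edge i)).injOn ((Finset.mem_filter_univ j).1 hj) rfl
      (hj'.trans hrank.symm)

variable [Fintype E]

theorem gap_lift (h : IsGapFunction G A γ) : h.lift.gap = γ := by
  classical
  funext o
  rcases (h.le_one o).lt_or_eq with hlt | heq
  · have hothers : h.lift.others o = 1 := by
      refine Finset.prod_eq_one fun o' ho' => ?_
      obtain ⟨hhead, hne⟩ := (Finset.mem_filter_univ o').1 ho'
      rw [h.depth_lift]
      exact (h.le_one o').eq_of_not_lt fun hlt' => hne (h.unique o' o hlt' hlt hhead)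
    rw [Lift.gap, if_pos (h.branched o hlt), hothers, h.depth_lift, max_eq_right hlt.le, div_one]
  · rw [heq, Lift.gap, h.depth_lift, heq, max_eq_left (h.lift.others_le_one o), div_one, ite_self]

theorem spread_lift (h : IsGapFunction G A γ) : h.lift.spread = h.lift := by
  refine Subtype.ext ?_
  change h.lift.arrangement.place h.lift.gap = A.place γ
  rw [h.arrangement_lift, h.gap_lift]

end IsGapFunction

/-! ### Continuity of the retraction -/

theorem continuous_apply_of_discreteTopology {D W Y : Type*} [TopologicalSpace D]
    [DiscreteTopology D] [TopologicalSpace W] [TopologicalSpace Y] {F : D → W → Y}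
    (hF : ∀ d, Continuous (F d)) {g : W → D} (hg : Continuous g) : Continuous fun w => F (g w) w :=
  ((continuous_prod_of_discrete_left (f := Function.uncurry F)).2 hF).comp
    (hg.prodMk continuous_id)

theorem continuous_ncard_of_isClopen {ι X : Type*} [Finite ι] [TopologicalSpace X]
    {P : X → ι → Prop} (hP : ∀ i, IsClopen {x | P x i}) :
    Continuous fun x => ({i | P x i}.ncard : ℝ) := by
  classical
  cases nonempty_fintype ι
  simp only [ncard_eq_toFinset_card', toFinset_ofPred, Finset.natCast_card_filter]
  exact continuous_finsetSum _ fun i _ =>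
    continuous_ite_of_isClopen (hP i) continuous_const continuous_const

namespace Lift

variable [TopologicalSpace E]

theorem continuous_val : Continuous fun z : G.Lift n => z.1 := continuous_subtype_val

theorem continuous_apply (i : Fin n) : Continuous fun z : G.Lift n => z.1 i :=
  (_root_.continuous_apply i).comp continuous_val

variable [DiscreteTopology E]

theorem isClopen_fst_eq (i : Fin n) (e : E) : IsClopen {z : G.Lift n | (z.1 i).1 = e} :=
  (isClopen_discrete {e}).preimage (continuous_fst.comp (continuous_apply i))

theorem continuous_ratio (b : Bool) (i : Fin n) :
    Continuous fun z : G.Lift n => z.ratio b i := by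
  have hdist : Continuous fun z : G.Lift n => (endDist b (z.1 i).2 : ℝ) :=
    continuous_subtype_val.comp
      ((continuous_endDist b).comp (continuous_snd.comp (continuous_apply i)))
  have hnext : Continuous fun z : G.Lift n => (nextDist b z.1 z.1 (z.1 i) : ℝ) := by
    refine continuous_subtype_val.comp
      (continuous_nextDist b continuous_val continuous_val (continuous_apply i) fun j => ?_)
    rcases eq_or_ne j i with rfl | hji
    · exact .inl fun z => rfl
    · exact .inr fun z => z.injective.ne hji
  refine hdist.div (hdist.max (hnext.sub hdist)) fun z => ?_
  rcases (unitInterval.nonneg' : 0 ≤ endDist b (z.1 i).2).eq_or_lt with hzero | hpos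
  · refine (lt_max_of_lt_right (sub_pos.2 (Subtype.coe_lt_coe.2 ?_))).ne'
    exact lt_nextDist (hzero ▸ zero_lt_one) fun j _ hj => hj
  · exact (lt_max_of_lt_left (Subtype.coe_lt_coe.2 hpos)).ne'

theorem continuous_depth (o : G.OrientedEdge) : Continuous fun z : G.Lift n => z.depth o := by
  classical
  simp only [depth, Finset.prod_filter]
  exact continuous_finsetProd _ fun i _ =>
    continuous_ite_of_isClopen (isClopen_fst_eq i o.1) (continuous_ratio o.2 i) continuous_const

theorem continuous_tokenCount (e : E) : Continuous fun z : G.Lift n => (z.tokenCount e : ℝ) :=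
  continuous_ncard_of_isClopen fun i => isClopen_fst_eq i e

theorem continuous_tokenRank (i : Fin n) : Continuous fun z : G.Lift n => (z.tokenRank i : ℝ) := by
  refine continuous_ncard_of_isClopen fun j => ?_
  rcases eq_or_ne i j with rfl | hij
  · simp only [lt_self_iff_false, and_false]
    exact isClopen_empty
  · convert isClopen_endDist_lt_endDist (continuous_apply j) (continuous_apply i)
      (fun z : G.Lift n => z.injective.ne hij) false using 3
    exact and_congr_left' eq_comm

variable [Fintype E]

theorem continuous_gap (o : G.OrientedEdge) : Continuous fun z : G.Lift n => z.gap o := by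
  classical
  have hothers : Continuous fun z : G.Lift n => z.others o :=
    continuous_finsetProd _ fun o' _ => continuous_depth o'
  exact Continuous.if_const _ ((continuous_depth o).div ((continuous_depth o).max hothers)
    fun z => (z.max_depth_others_pos o).ne') continuous_const

theorem continuous_spread : Continuous fun z : G.Lift n => z.spread := by
  have hunits (e : E) : Continuous fun z : G.Lift n => z.arrangement.units z.gap e :=
    (((continuous_gap _).add (continuous_gap _)).add (continuous_tokenCount e)).sub
      continuous_const
  refine Continuous.subtype_mk (continuous_pi fun i => ?_) _
  have hedge : Continuous fun z : G.Lift n => (z.1 i).1 := continuous_fst.comp (continuous_apply i)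
  have hfirst := continuous_apply_of_discreteTopology (fun e : E => continuous_gap (e, false)) hedge
  have hlength := continuous_apply_of_discreteTopology hunits hedge
  exact hedge.prodMk (continuous_projIcc.comp ((hfirst.add (continuous_tokenRank i)).div hlength
    fun z => (z.isGapFunction_gap.units_pos _).ne'))

end Lift

/-! ### Independence of the edge coordinates -/

namespace Lift

variable {z z' : G.Lift n}

theorem eq_or_endOf (h : z.conf = z'.conf) (i : Fin n) :
    z.1 i = z'.1 i ∨ ∃ o o', z.1 i = endOf o ∧ z'.1 i = endOf o' ∧ G.head o = G.head o' :=
  eq_or_endOf_of_chart_eq (congrFun (congrArg Subtype.val h) i)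

theorem eq_of_mem_Ioo (h : z.conf = z'.conf) {i : Fin n} (hi : ((z.1 i).2 : ℝ) ∈ Ioo (0 : ℝ) 1) :
    z.1 i = z'.1 i :=
  eq_of_chart_eq_of_mem_Ioo hi (congrFun (congrArg Subtype.val h) i)

theorem exists_endOf_of_ne (hV : ∀ v, G.IsFree v ∨ G.IsBranched v) (h : z.conf = z'.conf)
    {i : Fin n} (hi : z.1 i ≠ z'.1 i) :
    ∃ o o', z.1 i = endOf o ∧ z'.1 i = endOf o' ∧ G.head o = G.head o' ∧
      G.IsBranched (G.head o) := by
  obtain ⟨o, o', hz, hz', hhead⟩ := (eq_or_endOf h i).resolve_left hi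
  refine ⟨o, o', hz, hz', hhead, (hV _).resolve_left fun hfree => hi ?_⟩
  rw [hz, hz', hfree.eq_of_head rfl hhead.symm]

theorem ratio_congr (h : z.conf = z'.conf) {i : Fin n} (hi : z.1 i = z'.1 i) (b : Bool) :
    z.ratio b i = z'.ratio b i := by
  have hnext : nextDist b z.1 z.1 (z.1 i) = nextDist b z'.1 z'.1 (z.1 i) := by
    refine nextDist_congr fun j => ?_
    rcases eq_or_endOf h j with hj | ⟨o, o', hz, hz', -⟩
    · exact .inl ⟨hj, hj⟩
    · exact .inr ⟨o, o', hz, hz, hz', hz'⟩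
  rw [ratio, ratio, hnext, hi]

theorem ratio_eq_one {b : Bool} {i : Fin n} (hi : endDist b (z.1 i).2 = 1) : z.ratio b i = 1 := by
  have hnext : (nextDist b z.1 z.1 (z.1 i) : ℝ) ≤ 1 := unitInterval.le_one'
  rw [ratio, hi, Icc.coe_one, max_eq_left (by linarith), div_one]

open Classical in
theorem depth_congr (h : z.conf = z'.conf) {o : G.OrientedEdge}
    (ho : ∀ i, z.conf.1 i ≠ .vertex (G.head o)) : z.depth o = z'.depth o := by
  have hend {w : G.Lift n} (hw : ∀ i, w.conf.1 i ≠ .vertex (G.head o)) {i : Fin n}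
      {o' : G.OrientedEdge} (hi : w.1 i = endOf o') :
      (if (w.1 i).1 = o.1 then w.ratio o.2 i else 1) = 1 := by
    refine ite_eq_right_iff.2 fun hedge => ratio_eq_one ?_
    rw [hi]
    refine (endDist_endOf_eq_zero_or_one o.2 o').resolve_left fun hzero => hw i ?_
    have heq : w.1 i = endOf o := eq_endOf_of_endDist_eq_zero hedge (hi ▸ hzero)
    change G.chart (w.1 i) = _
    rw [heq, chart_endOf]
  rw [depth, depth, Finset.prod_filter, Finset.prod_filter]
  refine Finset.prod_congr rfl fun i _ => ?_
  rcases eq_or_endOf h i with hi | ⟨o₁, o₂, hz, hz', -⟩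
  · rw [hi, ratio_congr h hi]
  · rw [hend ho hz, hend (h ▸ ho) hz']

/-- The number of tokens at an end of an edge. -/
noncomputable def ends (z : G.Lift n) (o : G.OrientedEdge) : ℕ := {j | z.1 j = endOf o}.ncard

theorem ends_eq_one {o : G.OrientedEdge} {i : Fin n} (hi : z.1 i = endOf o) : z.ends o = 1 :=
  ncard_eq_one.2 ⟨i, Subset.antisymm (fun _ hj => z.injective (Eq.trans hj hi.symm))
    (singleton_subset_iff.2 hi)⟩

theorem ends_eq_zero {o : G.OrientedEdge} (h : ∀ i, z.1 i ≠ endOf o) : z.ends o = 0 :=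
  (ncard_eq_zero).2 (eq_empty_of_forall_notMem h)

theorem ends_congr_of_isFree (h : z.conf = z'.conf) {o : G.OrientedEdge}
    (ho : G.IsFree (G.head o)) : z.ends o = z'.ends o := by
  have himp {w w' : G.Lift n} (hw : w.conf = w'.conf) {j : Fin n} (hj : w.1 j = endOf o) :
      w'.1 j = endOf o := by
    rcases eq_or_endOf hw j with hj' | ⟨o₁, o₂, h₁, h₂, hhead⟩
    · exact hj' ▸ hj
    · obtain rfl : o₁ = o := endOf_injective (h₁.symm.trans hj)
      rw [h₂, ho.eq_of_head rfl hhead.symm]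
  exact congrArg ncard (Set.ext fun j => ⟨himp h, himp h.symm⟩)

/-- The tokens in the interior of an edge. -/
def innerTokens (z : G.Lift n) (e : E) : Set (Fin n) :=
  {j | (z.1 j).1 = e ∧ ((z.1 j).2 : ℝ) ∈ Ioo (0 : ℝ) 1}

/-- The number of tokens in the interior of an edge whose coordinate is smaller than that of the
point `p` on the same edge. -/
noncomputable def innerRank (z : G.Lift n) (p : E × unitInterval) : ℕ :=
  (z.innerTokens p.1 ∩ {j | (z.1 j).2 < p.2}).ncard

theorem innerTokens_congr (h : z.conf = z'.conf) (e : E) : z.innerTokens e = z'.innerTokens e := by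
  refine Set.ext fun j => ⟨fun hj => ?_, fun hj => ?_⟩
  · rwa [innerTokens, mem_ofPred_eq, ← eq_of_mem_Ioo h hj.2]
  · rwa [innerTokens, mem_ofPred_eq, ← eq_of_mem_Ioo h.symm hj.2]

theorem innerRank_congr (h : z.conf = z'.conf) (p : E × unitInterval) :
    z.innerRank p = z'.innerRank p := by
  rw [innerRank, innerRank, ← innerTokens_congr h]
  refine congrArg ncard (Set.ext fun j => and_congr_right fun hj => ?_)
  rw [mem_ofPred_eq, mem_ofPred_eq, eq_of_mem_Ioo h hj.2]

theorem notMem_innerTokens_of_eq_endOf {e : E} {j : Fin n} {o : G.OrientedEdge}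
    (hj : z.1 j = endOf o) : j ∉ z.innerTokens e :=
  fun hmem => endOf_notMem_Ioo o (hj ▸ hmem.2)

theorem tokenCount_eq (z : G.Lift n) (e : E) :
    z.tokenCount e = (z.innerTokens e).ncard + z.ends (e, false) + z.ends (e, true) := by
  have hunion : {j | (z.1 j).1 = e} =
      z.innerTokens e ∪ {j | z.1 j = endOf (e, false)} ∪ {j | z.1 j = endOf (e, true)} := by
    ext j
    constructor
    · rintro rfl
      rcases eq_endOf_or_mem_Ioo (z.1 j) with ⟨_ | _, hb⟩ | hi
      · exact .inl (.inr hb)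
      · exact .inr hb
      · exact .inl (.inl ⟨rfl, hi⟩)
    · rintro ((hj | hj) | hj)
      · exact hj.1
      · exact congrArg Prod.fst hj
      · exact congrArg Prod.fst hj
  rw [tokenCount, hunion, ncard_union_eq, ncard_union_eq, ends, ends]
  · exact disjoint_right.2 fun j hj => notMem_innerTokens_of_eq_endOf hj
  · refine disjoint_right.2 fun j hj hj' => hj'.elim (notMem_innerTokens_of_eq_endOf hj) ?_
    intro hj'
    exact Bool.false_ne_true (congrArg Prod.snd (endOf_injective (Eq.trans hj'.symm hj)))

theorem tokenRank_eq (z : G.Lift n) {i : Fin n} (hi : 0 < (z.1 i).2) :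
    z.tokenRank i = z.innerRank (z.1 i) + z.ends ((z.1 i).1, false) := by
  have hunion : {j | (z.1 j).1 = (z.1 i).1 ∧ (z.1 j).2 < (z.1 i).2} =
      z.innerTokens (z.1 i).1 ∩ {j | (z.1 j).2 < (z.1 i).2} ∪
        {j | z.1 j = endOf ((z.1 i).1, false)} := by
    ext j
    constructor
    · rintro ⟨hedge, hlt⟩
      rcases eq_endOf_or_mem_Ioo (z.1 j) with ⟨b, hb⟩ | hj
      · rw [hedge] at hb
        cases b
        · exact .inr hb
        · rw [hb] at hlt
          exact absurd unitInterval.le_one' hlt.not_ge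
      · exact .inl ⟨⟨hedge, hj⟩, hlt⟩
    · rintro (hj | hj)
      · exact ⟨hj.1.1, hj.2⟩
      · rw [mem_ofPred_eq] at hj
        rw [mem_ofPred_eq, hj]
        exact ⟨rfl, hi⟩
  rw [tokenRank, hunion, ncard_union_eq, innerRank, ends]
  exact disjoint_right.2 fun j hj hj' => notMem_innerTokens_of_eq_endOf hj hj'.1

variable [Fintype E]

theorem gap_add_ends_eq_one {o : G.OrientedEdge} (ho : G.IsBranched (G.head o)) {k : Fin n}
    (hk : z.conf.1 k = .vertex (G.head o)) : z.gap o + z.ends o = 1 := by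
  classical
  by_cases hocc : ∃ i, z.1 i = endOf o
  · rw [(z.gap_eq_zero_iff ho).2 hocc, ends_eq_one hocc.choose_spec, Nat.cast_one, zero_add]
  · have hothers : z.others o = 0 := by
      rcases eq_or_endOf_of_chart_eq (hk.trans (chart_endOf G o).symm) with
        hk' | ⟨o₁, o₂, h₁, h₂, hhead⟩
      · exact absurd ⟨k, hk'⟩ hocc
      · obtain rfl := endOf_injective h₂
        have hne : o₁ ≠ o := by
          rintro rfl
          exact hocc ⟨k, h₁⟩
        exact Finset.prod_eq_zero ((Finset.mem_filter_univ o₁).2 ⟨hhead, hne⟩)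
          ((z.depth_eq_zero_iff o₁).2 ⟨k, h₁⟩)
    have hpos := z.max_depth_others_pos o
    rw [hothers, max_eq_left (z.depth_nonneg o)] at hpos
    push Not at hocc
    rw [gap, if_pos ho, hothers, max_eq_left hpos.le, div_self hpos.ne', ends_eq_zero hocc,
      Nat.cast_zero, add_zero]

theorem gap_congr (h : z.conf = z'.conf) {o : G.OrientedEdge}
    (ho : ∀ i, z.conf.1 i ≠ .vertex (G.head o)) : z.gap o = z'.gap o := by
  classical
  have hothers : z.others o = z'.others o :=
    Finset.prod_congr rfl fun o' ho' =>
      depth_congr h (by rwa [((Finset.mem_filter_univ o').1 ho').1])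
  rw [gap, gap, hothers, depth_congr h ho]

theorem gap_add_ends_congr (hV : ∀ v, G.IsFree v ∨ G.IsBranched v) (h : z.conf = z'.conf)
    (o : G.OrientedEdge) : z.gap o + z.ends o = z'.gap o + z'.ends o := by
  rcases hV (G.head o) with hfree | hb
  · rw [gap, gap, if_neg hfree.not_isBranched, if_neg hfree.not_isBranched,
      ends_congr_of_isFree h hfree]
  · by_cases hocc : ∃ k, z.conf.1 k = .vertex (G.head o)
    · obtain ⟨k, hk⟩ := hocc
      rw [gap_add_ends_eq_one hb hk, gap_add_ends_eq_one hb (h ▸ hk)]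
    · push Not at hocc
      have hends {w : G.Lift n} (hw : ∀ k, w.conf.1 k ≠ .vertex (G.head o)) : w.ends o = 0 :=
        ends_eq_zero fun i hi => hw i ((congrArg G.chart hi).trans (chart_endOf G o))
      rw [gap_congr h hocc, hends hocc, hends (h ▸ hocc)]

theorem units_congr (hV : ∀ v, G.IsFree v ∨ G.IsBranched v) (h : z.conf = z'.conf) (e : E) :
    z.arrangement.units z.gap e = z'.arrangement.units z'.gap e := by
  have hcount (w : G.Lift n) : (w.arrangement.count e : ℝ) =
      (w.innerTokens e).ncard + w.ends (e, false) + w.ends (e, true) := by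
    exact_mod_cast w.tokenCount_eq e
  have hinner := innerTokens_congr h e
  have hfalse := gap_add_ends_congr hV h (e, false)
  have htrue := gap_add_ends_congr hV h (e, true)
  rw [Arrangement.units, Arrangement.units, hcount, hcount, hinner]
  linarith

theorem gap_add_tokenRank_congr (hV : ∀ v, G.IsFree v ∨ G.IsBranched v) (h : z.conf = z'.conf)
    {i : Fin n} (hi : z.1 i = z'.1 i) :
    z.gap ((z.1 i).1, false) + z.tokenRank i = z'.gap ((z.1 i).1, false) + z'.tokenRank i := by
  have hsum := gap_add_ends_congr hV h ((z.1 i).1, false)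
  rcases eq_or_ne (z.1 i).2 0 with hzero | hpos
  · have hz : z.1 i = endOf ((z.1 i).1, false) := Prod.ext rfl hzero
    have hz' : z'.1 i = endOf ((z.1 i).1, false) := hi ▸ hz
    have hrank : z.tokenRank i = 0 := z.rankFrom_eq_zero_of_eq_endOf hz
    have hrank' : z'.tokenRank i = 0 := z'.rankFrom_eq_zero_of_eq_endOf hz'
    rw [ends_eq_one hz, ends_eq_one hz'] at hsum
    rw [hrank, hrank']
    linarith
  · have hpos : 0 < (z.1 i).2 := unitInterval.pos_iff_ne_zero.2 hpos
    rw [z.tokenRank_eq hpos, z'.tokenRank_eq (hi ▸ hpos), ← hi, innerRank_congr h]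
    push_cast
    linarith

theorem spread_congr (hV : ∀ v, G.IsFree v ∨ G.IsBranched v) (h : z.conf = z'.conf) {i : Fin n}
    (hi : z.1 i = z'.1 i) : z.spread.1 i = z'.spread.1 i := by
  have hedge : (z.1 i).1 = (z'.1 i).1 := congrArg Prod.fst hi
  refine Prod.ext hedge (congrArg (projIcc (0 : ℝ) 1 zero_le_one) ?_)
  change (z.gap ((z.1 i).1, false) + z.tokenRank i) / z.arrangement.units z.gap (z.1 i).1 =
    (z'.gap ((z'.1 i).1, false) + z'.tokenRank i) / z'.arrangement.units z'.gap (z'.1 i).1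
  rw [gap_add_tokenRank_congr hV h hi, units_congr hV h, hedge]

theorem conf_spread_congr (hV : ∀ v, G.IsFree v ∨ G.IsBranched v) (h : z.conf = z'.conf) :
    z.spread.conf = z'.spread.conf := by
  refine Subtype.ext (funext fun i => ?_)
  change G.chart (z.spread.1 i) = G.chart (z'.spread.1 i)
  by_cases hi : z.1 i = z'.1 i
  · rw [spread_congr hV h hi]
  · obtain ⟨o, o', hz, hz', hhead, hb⟩ := exists_endOf_of_ne hV h hi
    rw [z.spread_eq_endOf_iff.2 ⟨hb, hz⟩, z'.spread_eq_endOf_iff.2 ⟨hhead ▸ hb, hz'⟩, chart_endOf,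
      chart_endOf, hhead]

theorem spread_eq_of_conf_eq (hV : ∀ v, G.IsFree v ∨ G.IsBranched v) (h : z.conf = z'.conf)
    (hz : z.spread = z) : z'.spread = z' := by
  have hconf : z'.spread.conf = z'.conf := by rw [← conf_spread_congr hV h, hz, h]
  refine Subtype.ext (funext fun i => ?_)
  rcases eq_or_endOf hconf i with hi | ⟨o, o', ho, ho', hhead⟩
  · exact hi
  · have hb := (z'.spread_eq_endOf_iff.1 ho).1
    exact (z'.spread_eq_endOf_iff.2 ⟨hhead ▸ hb, ho'⟩).trans ho'.symm

end Lift

/-! ### The face of a gap function -/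

open Classical in
/-- The element with the property `P`, if there is one. -/
noncomputable def optionOf {ι : Type*} (P : ι → Prop) : Option ι :=
  if h : ∃ i, P i then some h.choose else none

theorem optionOf_eq_some_iff {ι : Type*} {P : ι → Prop} (hP : ∀ i j, P i → P j → i = j) {i : ι} :
    optionOf P = some i ↔ P i := by
  unfold optionOf
  split_ifs with h
  · rw [Option.some_inj]
    exact ⟨fun hi => hi ▸ h.choose_spec, hP _ _ h.choose_spec⟩
  · simp only [false_iff]
    exact fun hi => h ⟨i, hi⟩

open Classical in
/-- The number (`0` or `1`) of tokens that are moving to the head of `o` or have arrived there. -/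
noncomputable def outerCount (γ : E × Bool → ℝ) (o : E × Bool) : ℕ := if γ o < 1 then 1 else 0

namespace Arrangement

variable (A : Arrangement E n) {γ : E × Bool → ℝ} {i : Fin n}

/-- The token `i` is moving to the head of `o` or has arrived there. -/
def IsOuter (γ : E × Bool → ℝ) (i : Fin n) (o : E × Bool) : Prop :=
  A.edge i = o.1 ∧ A.rankFrom o.2 i = 0 ∧ γ o < 1

theorem not_exists_isOuter_iff : (¬ ∃ o, A.IsOuter γ i o) ↔
    outerCount γ (A.edge i, false) ≤ A.rank i ∧
      A.rank i + outerCount γ (A.edge i, true) < A.count (A.edge i) := by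
  have hlt := A.rank_lt_count i
  have hends : (∃ o, A.IsOuter γ i o) ↔ (A.rank i = 0 ∧ γ (A.edge i, false) < 1) ∨
      (A.count (A.edge i) - 1 - A.rank i = 0 ∧ γ (A.edge i, true) < 1) := by
    simp [IsOuter, rankFrom]
  rw [hends]
  unfold outerCount
  split_ifs with hfalse htrue htrue <;> simp [hfalse, htrue] <;> omega

/-- The stationary tokens on an edge. -/
noncomputable def innerList (γ : E × Bool → ℝ) (e : E) : List (Fin n) :=
  List.ofFn fun k : Fin (A.count e - outerCount γ (e, false) - outerCount γ (e, true)) =>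
    ((A.bijOn_rank e).surjOn
      (show k + outerCount γ (e, false) < A.count e by omega)).choose

theorem length_innerList (γ : E × Bool → ℝ) (e : E) : (A.innerList γ e).length =
    A.count e - outerCount γ (e, false) - outerCount γ (e, true) :=
  List.length_ofFn

theorem get_innerList_eq_iff {e : E} {k : Fin (A.innerList γ e).length} :
    (A.innerList γ e).get k = i ↔ A.edge i = e ∧ A.rank i = k + outerCount γ (e, false) := by
  have hk : k + outerCount γ (e, false) < A.count e := by
    have := k.2.trans_eq (A.length_innerList γ e)
    omega
  obtain ⟨hedge, hrank⟩ := ((A.bijOn_rank e).surjOn hk).choose_spec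
  rw [show (A.innerList γ e).get k = ((A.bijOn_rank e).surjOn hk).choose from List.get_ofFn _ _]
  constructor
  · rintro rfl
    exact ⟨hedge, hrank⟩
  · exact fun ⟨hedge', hrank'⟩ => (A.bijOn_rank e).injOn hedge hedge' (hrank.trans hrank'.symm)

theorem not_exists_isOuter_of_get_innerList_eq {e : E} {k : Fin (A.innerList γ e).length}
    (h : (A.innerList γ e).get k = i) : ¬ ∃ o, A.IsOuter γ i o := by
  obtain ⟨rfl, hrank⟩ := A.get_innerList_eq_iff.1 h
  have hk := k.2.trans_eq (A.length_innerList γ _)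
  rw [A.not_exists_isOuter_iff]
  omega

/-- The token at a vertex. -/
noncomputable def vertexToken (G : CellGraph V E) (γ : G.OrientedEdge → ℝ) (v : V) :
    Option (Fin n) :=
  optionOf fun i => ∃ o, A.IsOuter γ i o ∧ γ o = 0 ∧ G.head o = v

/-- The token that moves towards the head of an oriented edge. -/
noncomputable def movingToken (γ : E × Bool → ℝ) (o : E × Bool) : Option (Fin n) :=
  optionOf fun i => A.IsOuter γ i o ∧ 0 < γ o

variable {A}

theorem IsOuter.eq {j : Fin n} {o : E × Bool} (hi : A.IsOuter γ i o) (hj : A.IsOuter γ j o) :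
    i = j :=
  (A.bijOn_rankFrom o.2 o.1).injOn hi.1 hj.1 (hi.2.1.trans hj.2.1.symm)

theorem movingToken_eq_some_iff {o : E × Bool} :
    A.movingToken γ o = some i ↔ A.IsOuter γ i o ∧ 0 < γ o :=
  optionOf_eq_some_iff fun _ _ hi hj => hi.1.eq hj.1

end Arrangement

namespace IsGapFunction

open Arrangement

variable {A : Arrangement E n} {γ : G.OrientedEdge → ℝ} {i : Fin n}

theorem outerCount_add_outerCount_le (h : IsGapFunction G A γ) (e : E) :
    outerCount γ (e, false) + outerCount γ (e, true) ≤ A.count e := by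
  unfold outerCount
  split_ifs with hfalse htrue htrue
  · exact h.two_le e hfalse htrue
  · exact h.count_pos _ hfalse
  · exact h.count_pos _ htrue
  · exact Nat.zero_le _

theorem eq_of_isOuter (h : IsGapFunction G A γ) {o o' : G.OrientedEdge}
    (ho : A.IsOuter γ i o) (ho' : A.IsOuter γ i o') : o = o' := by
  obtain ⟨e, b⟩ := o
  obtain ⟨e', b'⟩ := o'
  obtain ⟨rfl, hrank, hlt⟩ := ho
  obtain ⟨rfl, hrank', hlt'⟩ := ho'
  refine Prod.ext rfl ?_
  by_contra! hne
  obtain rfl : b' = !b := (Bool.eq_not_of_ne hne.symm)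
  have hcount : 2 ≤ A.count (A.edge i) := by
    cases b
    · exact h.two_le _ hlt hlt'
    · exact h.two_le _ hlt' hlt
  have := A.rankFrom_not_add_rankFrom_add_one b i
  simp only at hrank hrank'
  omega

theorem vertexToken_eq_some_iff (h : IsGapFunction G A γ) {v : V} :
    A.vertexToken G γ v = some i ↔ ∃ o, A.IsOuter γ i o ∧ γ o = 0 ∧ G.head o = v := by
  refine optionOf_eq_some_iff ?_
  rintro i j ⟨o, hi, -, rfl⟩ ⟨o', hj, -, hhead⟩
  obtain rfl := h.unique o' o hj.2.2 hi.2.2 hhead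
  exact hi.eq hj

theorem isSome_movingToken_iff (h : IsGapFunction G A γ) {o : G.OrientedEdge} :
    (A.movingToken γ o).isSome ↔ 0 < γ o ∧ γ o < 1 := by
  rw [Option.isSome_iff_exists]
  constructor
  · rintro ⟨i, hi⟩
    obtain ⟨hi, hpos⟩ := movingToken_eq_some_iff.1 hi
    exact ⟨hpos, hi.2.2⟩
  · rintro ⟨hpos, hlt⟩
    obtain ⟨i, hedge, hrank⟩ := (A.bijOn_rankFrom o.2 o.1).surjOn (h.count_pos o hlt)
    exact ⟨i, movingToken_eq_some_iff.2 ⟨⟨hedge, hrank, hlt⟩, hpos⟩⟩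

open Classical in
theorem slotLabel_eq_some_iff_of_isOuter (h : IsGapFunction G A γ) {o : G.OrientedEdge}
    (hi : A.IsOuter γ i o) {c : G.Slot n (A.innerList γ)} :
    slotLabel (A.innerList γ) (A.vertexToken G γ) (A.movingToken γ) c = some i ↔
      c = if γ o = 0 then .inr (.inl (G.head o)) else .inr (.inr o) := by
  rcases c with ⟨e, k⟩ | v | o'
  · refine iff_of_false (fun hc => ?_) (by split_ifs <;> simp)
    exact A.not_exists_isOuter_of_get_innerList_eq (Option.some_inj.1 hc) ⟨o, hi⟩
  · refine h.vertexToken_eq_some_iff.trans ⟨?_, fun hv => ?_⟩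
    · rintro ⟨o', hi', hzero, rfl⟩
      obtain rfl := h.eq_of_isOuter hi hi'
      rw [if_pos hzero]
    · split_ifs at hv with hzero
      · exact ⟨o, hi, hzero, (Sum.inl_injective (Sum.inr_injective hv)).symm⟩
      · cases hv
  · refine movingToken_eq_some_iff.trans ⟨?_, fun ho' => ?_⟩
    · rintro ⟨hi', hpos⟩
      obtain rfl := h.eq_of_isOuter hi hi'
      rw [if_neg hpos.ne']
    · split_ifs at ho' with hzero
      · cases ho'
      · cases ho'
        exact ⟨hi, (h.nonneg o).lt_of_ne' hzero⟩

theorem existsUnique_slotLabel_eq_some_of_not_isOuter (h : IsGapFunction G A γ)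
    (hi : ¬ ∃ o, A.IsOuter γ i o) : ∃! c : G.Slot n (A.innerList γ),
      slotLabel (A.innerList γ) (A.vertexToken G γ) (A.movingToken γ) c = some i := by
  obtain ⟨hfalse, htrue⟩ := A.not_exists_isOuter_iff.1 hi
  have hk : A.rank i - outerCount γ (A.edge i, false) < (A.innerList γ (A.edge i)).length := by
    rw [A.length_innerList]
    omega
  refine ⟨.inl ⟨A.edge i, _, hk⟩, congrArg some ?_, ?_⟩
  · exact A.get_innerList_eq_iff.2 ⟨rfl, (Nat.sub_add_cancel hfalse).symm⟩
  · rintro (⟨e, k⟩ | v | o) hc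
    · obtain ⟨rfl, hrank⟩ := A.get_innerList_eq_iff.1 (Option.some_inj.1 hc)
      obtain rfl : k = ⟨_, hk⟩ := Fin.ext (Nat.eq_sub_of_add_eq hrank.symm)
      rfl
    · obtain ⟨o, ho, -⟩ := h.vertexToken_eq_some_iff.1 hc
      exact absurd ⟨o, ho⟩ hi
    · exact absurd ⟨o, (movingToken_eq_some_iff.1 hc).1⟩ hi

/-- The face of the cube complex with a given arrangement and gaps. -/
noncomputable def face (h : IsGapFunction G A γ) : G.Face n where
  onEdge := A.innerList γ
  atVertex := A.vertexToken G γ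
  moving := A.movingToken γ
  atVertex_branched v hv := by
    obtain ⟨i, hi⟩ := Option.isSome_iff_exists.1 hv
    obtain ⟨o, ho, -, rfl⟩ := h.vertexToken_eq_some_iff.1 hi
    exact h.branched o ho.2.2
  moving_branched o ho := h.branched o (h.isSome_movingToken_iff.1 ho).2
  atVertex_eq_none o ho := by
    refine Option.eq_none_iff_forall_ne_some.2 fun i hi => ?_
    obtain ⟨o', ho', hzero, hhead⟩ := h.vertexToken_eq_some_iff.1 hi
    obtain ⟨hpos, hlt⟩ := h.isSome_movingToken_iff.1 ho
    obtain rfl := h.unique o' o ho'.2.2 hlt hhead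
    exact hpos.ne' hzero
  moving_unique o o' ho ho' :=
    h.unique o o' (h.isSome_movingToken_iff.1 ho).2 (h.isSome_movingToken_iff.1 ho').2
  occurs_once i := by
    classical
    by_cases hi : ∃ o, A.IsOuter γ i o
    · obtain ⟨o, ho⟩ := hi
      exact ⟨_, (h.slotLabel_eq_some_iff_of_isOuter ho).2 rfl,
        fun c => (h.slotLabel_eq_some_iff_of_isOuter ho).1⟩
    · exact h.existsUnique_slotLabel_eq_some_of_not_isOuter hi

/-- The position of the configuration with the given gaps in the cube of its face. -/
noncomputable def cube (h : IsGapFunction G A γ) : h.face.Cube := fun o =>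
  ⟨1 - γ o.1, by linarith [h.le_one o.1], by linarith [h.nonneg o.1]⟩

theorem gap_face (h : IsGapFunction G A γ) {o : G.OrientedEdge} (ho : (h.face.moving o).isSome) :
    h.face.gap h.cube o = γ o := by
  rw [Face.gap, dif_pos ho]
  exact sub_sub_cancel _ _

theorem margin_face (h : IsGapFunction G A γ) (o : G.OrientedEdge) :
    h.face.margin h.cube o = γ o + outerCount γ o := by
  unfold Face.margin
  split_ifs with ho
  · rw [h.gap_face ho, outerCount, if_pos (h.isSome_movingToken_iff.1 ho).2, Nat.cast_one]
  · rcases (h.nonneg o).eq_or_lt with hzero | hpos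
    · simp [outerCount, ← hzero]
    · have hlt : ¬ γ o < 1 := fun hlt => ho (h.isSome_movingToken_iff.2 ⟨hpos, hlt⟩)
      rw [outerCount, if_neg hlt, (h.le_one o).eq_of_not_lt hlt, Nat.cast_zero, add_zero]

theorem units_face (h : IsGapFunction G A γ) (e : E) : h.face.units h.cube e = A.units γ e := by
  have hle := h.outerCount_add_outerCount_le e
  have hlength : ((h.face.onEdge e).length : ℝ) =
      A.count e - outerCount γ (e, false) - outerCount γ (e, true) := by
    rw [show (h.face.onEdge e).length = _ from A.length_innerList γ e, Nat.cast_sub (by omega),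
      Nat.cast_sub (by omega)]
  rw [Face.units, h.margin_face, h.margin_face, hlength, Arrangement.units]
  ring

theorem chart_place (h : IsGapFunction G A γ) (i : Fin n) : G.chart (A.place γ i) =
    G.edgePoint (A.edge i) ((γ (A.edge i, false) + A.rank i) / A.units γ (A.edge i)) :=
  congrArg (G.edgePoint (A.edge i)) (h.endDist_place false i)

theorem slotPoint_face (h : IsGapFunction G A γ) {c : G.Slot n h.face.onEdge}
    (hc : h.face.label c = some i) : h.face.slotPoint h.cube c = G.chart (A.place γ i) := by
  rcases c with ⟨e, k⟩ | v | ⟨e, b⟩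
  · obtain ⟨rfl, hrank⟩ := A.get_innerList_eq_iff.1 (Option.some_inj.1 hc)
    change G.edgePoint _ ((h.face.margin h.cube _ + (k : ℕ)) / h.face.units h.cube _) = _
    rw [h.chart_place, hrank, h.margin_face, h.units_face]
    congr 2
    push_cast
    ring
  · obtain ⟨o, ho, hzero, rfl⟩ := h.vertexToken_eq_some_iff.1 hc
    rw [h.place_eq_endOf_iff.2 ⟨ho.1, hzero, ho.2.1⟩, chart_endOf]
    rfl
  · have ho : (h.face.moving (e, b)).isSome := Option.isSome_iff_exists.2 ⟨i, hc⟩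
    obtain ⟨⟨rfl, hrank, -⟩, -⟩ := movingToken_eq_some_iff.1 hc
    have hdist := h.endDist_place b i
    rw [show A.rankFrom b i = 0 from hrank, Nat.cast_zero, add_zero] at hdist
    cases b
    · change G.edgePoint _ (h.face.gap h.cube _ / h.face.units h.cube _) = _
      rw [h.gap_face ho, h.units_face, ← hdist]
      rfl
    · change G.edgePoint _ (1 - h.face.gap h.cube _ / h.face.units h.cube _) = _
      rw [h.gap_face ho, h.units_face, ← hdist, ← coe_endDist_not]
      rfl

theorem cellMap_face (h : IsGapFunction G A γ) : h.face.cellMap h.cube = h.lift.conf :=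
  Subtype.ext (funext fun i => h.slotPoint_face (h.face.label_slotOf i))

theorem conf_lift_mem_cubeComplex (h : IsGapFunction G A γ) : h.lift.conf ∈ G.cubeComplex n :=
  ⟨h.face, h.cube, h.cellMap_face⟩

theorem isEmpty_moving_face (h : IsGapFunction G A γ) (hγ : ∀ o, γ o = 0 ∨ γ o = 1) :
    IsEmpty {o : G.OrientedEdge // (h.face.moving o).isSome} := by
  refine ⟨fun o => ?_⟩
  obtain ⟨hpos, hlt⟩ := h.isSome_movingToken_iff.1 o.2
  exact (hγ o.1).elim hpos.ne' hlt.ne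

theorem dim_face (h : IsGapFunction G A γ) (hγ : ∀ o, γ o = 0 ∨ γ o = 1) : h.face.dim = 0 :=
  Nat.card_eq_zero.2 (.inl (h.isEmpty_moving_face hγ))

theorem vertexConf_face (h : IsGapFunction G A γ) (hγ : ∀ o, γ o = 0 ∨ γ o = 1) :
    h.face.vertexConf = h.lift.conf := by
  have := h.isEmpty_moving_face hγ
  rw [← h.cellMap_face, Face.vertexConf]
  exact congrArg _ (Subsingleton.elim _ _)

end IsGapFunction

theorem Lift.conf_spread_mem_cubeComplex [Fintype E] (z : G.Lift n) :
    z.spread.conf ∈ G.cubeComplex n :=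
  z.isGapFunction_gap.conf_lift_mem_cubeComplex

/-! ### The lifted configurations of a face -/

theorem bijOn_idxOf {α : Type*} [DecidableEq α] {l : List α} (hl : l.Nodup) :
    BijOn l.idxOf {a | a ∈ l} (Iio l.length) :=
  ⟨fun _ ha => List.idxOf_lt_length_iff.2 ha, fun _ ha _ _ hab => (List.idxOf_inj ha).1 hab,
    fun k hk => ⟨l[k], List.getElem_mem hk, hl.idxOf_getElem k hk⟩⟩

namespace Face

variable (F : G.Face n) (ov : V → G.OrientedEdge)

theorem slotOf_eq_iff {c : G.Slot n F.onEdge} {i : Fin n} :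
    F.slotOf i = c ↔ F.label c = some i :=
  ⟨fun h => h ▸ F.label_slotOf i, (F.occurs_once i).unique (F.label_slotOf i)⟩

open Classical in
/-- The token that moves towards the head of `o` or is at the head of `o`, where a token at a
vertex `v` is assigned to the oriented edge `ov v`. -/
noncomputable def outerToken (o : G.OrientedEdge) : Option (Fin n) :=
  if (F.moving o).isSome then F.moving o
  else if ov (G.head o) = o then F.atVertex (G.head o) else none

theorem outerToken_eq_some_iff {o : G.OrientedEdge} {i : Fin n} :
    F.outerToken ov o = some i ↔ F.slotOf i = .inr (.inr o) ∨
      F.slotOf i = .inr (.inl (G.head o)) ∧ ov (G.head o) = o := by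
  simp only [slotOf_eq_iff, label, slotLabel, outerToken]
  split_ifs with hmoving ho
  · simp [F.atVertex_eq_none o hmoving]
  · simp [Option.not_isSome_iff_eq_none.1 hmoving, ho]
  · simp [Option.not_isSome_iff_eq_none.1 hmoving, ho]

theorem eq_of_outerToken_eq_some {o o' : G.OrientedEdge} {i j : Fin n}
    (h : F.outerToken ov o = some i) (h' : F.outerToken ov o' = some j)
    (ho : G.head o = G.head o') : o = o' := by
  simp only [outerToken_eq_some_iff, slotOf_eq_iff] at h h'
  rcases h with h | ⟨h, hov⟩ <;> rcases h' with h' | ⟨h', hov'⟩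
  · exact F.moving_unique o o' (Option.isSome_of_eq_some h) (Option.isSome_of_eq_some h') ho
  · have := F.atVertex_eq_none o (Option.isSome_of_eq_some h)
    rw [ho] at this
    exact absurd (h'.symm.trans this) (Option.some_ne_none j)
  · have := F.atVertex_eq_none o' (Option.isSome_of_eq_some h')
    rw [← ho] at this
    exact absurd (h.symm.trans this) (Option.some_ne_none i)
  · rw [← hov, ho, hov']

/-- The tokens on an edge in their order along the edge. -/
noncomputable def tokens (e : E) : List (Fin n) :=
  (F.outerToken ov (e, false)).toList ++ F.onEdge e ++ (F.outerToken ov (e, true)).toList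

/-- The edge to which a slot is assigned. -/
def slotEdge : G.Slot n F.onEdge → E
  | .inl c => c.1
  | .inr (.inl v) => (ov v).1
  | .inr (.inr o) => o.1

theorem slotEdge_of_outerToken {o : G.OrientedEdge} {i : Fin n}
    (h : F.outerToken ov o = some i) : F.slotEdge ov (F.slotOf i) = o.1 := by
  rcases (F.outerToken_eq_some_iff ov).1 h with h | ⟨h, hov⟩
  · rw [h, slotEdge]
  · rw [h, slotEdge, hov]

theorem mem_onEdge_iff {e : E} {i : Fin n} :
    i ∈ F.onEdge e ↔ ∃ k, F.slotOf i = .inl ⟨e, k⟩ := by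
  rw [List.mem_iff_get]
  exact exists_congr fun k => by simp only [slotOf_eq_iff, label, slotLabel, Option.some_inj]

theorem mem_tokens_of_outerToken {o : G.OrientedEdge} {i : Fin n}
    (h : F.outerToken ov o = some i) : i ∈ F.tokens ov o.1 := by
  obtain ⟨e, _ | _⟩ := o <;> simp [tokens, h]

variable {ov} in
theorem mem_tokens_iff (hov : Function.RightInverse ov G.head) {e : E} {i : Fin n} :
    i ∈ F.tokens ov e ↔ F.slotEdge ov (F.slotOf i) = e := by
  constructor
  · simp only [tokens, List.mem_append, Option.mem_toList]
    rintro ((h | h) | h)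
    · exact F.slotEdge_of_outerToken ov h
    · obtain ⟨k, hk⟩ := F.mem_onEdge_iff.1 h
      rw [hk, slotEdge]
    · exact F.slotEdge_of_outerToken ov h
  · rintro rfl
    rcases hi : F.slotOf i with ⟨e, k⟩ | v | o
    · simp only [tokens, slotEdge, List.mem_append]
      exact .inl (.inr (F.mem_onEdge_iff.2 ⟨k, hi⟩))
    · refine F.mem_tokens_of_outerToken ov (o := ov v) ((F.outerToken_eq_some_iff ov).2 (.inr ?_))
      rw [hov v]
      exact ⟨hi, rfl⟩
    · exact F.mem_tokens_of_outerToken ov ((F.outerToken_eq_some_iff ov).2 (.inl hi))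

theorem nodup_onEdge (e : E) : (F.onEdge e).Nodup := by
  refine List.nodup_iff_injective_get.2 fun k l hkl => ?_
  have hl : F.slotOf ((F.onEdge e).get l) = .inl ⟨e, l⟩ := F.slotOf_eq_iff.2 rfl
  have hk : F.slotOf ((F.onEdge e).get l) = .inl ⟨e, k⟩ := F.slotOf_eq_iff.2 (congrArg some hkl)
  simpa using hk.symm.trans hl

theorem outerToken_injective {o o' : G.OrientedEdge} {i : Fin n}
    (h : F.outerToken ov o = some i) (h' : F.outerToken ov o' = some i) : o = o' := by
  rw [outerToken_eq_some_iff] at h h'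
  rcases h with h | ⟨h, hov⟩ <;> rcases h' with h' | ⟨h', hov'⟩
  · simpa using h.symm.trans h'
  · simpa using h.symm.trans h'
  · simpa using h.symm.trans h'
  · have hhead : G.head o = G.head o' := by simpa using h.symm.trans h'
    rw [← hov, hhead, hov']

theorem nodup_tokens (e : E) : (F.tokens ov e).Nodup := by
  have hdisjoint : ∀ o i, F.outerToken ov o = some i → i ∉ F.onEdge e := by
    intro o i ho hi
    obtain ⟨k, hk⟩ := F.mem_onEdge_iff.1 hi
    rcases (F.outerToken_eq_some_iff ov).1 ho with h | ⟨h, -⟩ <;> simp [hk] at h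
  simp only [tokens, List.nodup_append, List.mem_append, Option.mem_toList]
  refine ⟨⟨Option.toList_nodup _, F.nodup_onEdge e, ?_⟩, Option.toList_nodup _, ?_⟩
  · rintro i hi j hj rfl
    exact hdisjoint _ _ hi hj
  · rintro i (hi | hi) j hj rfl
    · simpa using F.outerToken_injective ov hi hj
    · exact hdisjoint _ _ hj hi

variable {ov} (hov : Function.RightInverse ov G.head)

/-- The arrangement of the tokens of a face. -/
noncomputable def arrangement : Arrangement E n where
  edge i := F.slotEdge ov (F.slotOf i)
  count e := (F.tokens ov e).length
  rank i := (F.tokens ov (F.slotEdge ov (F.slotOf i))).idxOf i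
  bijOn_rank e := by
    rw [show {i | F.slotEdge ov (F.slotOf i) = e} = {i | i ∈ F.tokens ov e} from
      Set.ext fun i => (F.mem_tokens_iff hov).symm]
    refine (bijOn_idxOf (F.nodup_tokens ov e)).congr fun i hi => ?_
    simp only [(F.mem_tokens_iff hov).1 hi]

theorem rankFrom_of_outerToken {o : G.OrientedEdge} {i : Fin n}
    (h : F.outerToken ov o = some i) : (F.arrangement hov).rankFrom o.2 i = 0 := by
  have hedge := F.slotEdge_of_outerToken ov h
  obtain ⟨e, b⟩ := o
  cases b
  · simp [Arrangement.rankFrom, arrangement, hedge, tokens, h]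
  · have hnodup := F.nodup_tokens ov e
    simp only [tokens, h, Option.toList_some, List.nodup_append, List.mem_singleton] at hnodup
    have hi : i ∉ (F.outerToken ov (e, false)).toList ++ F.onEdge e :=
      fun hi => hnodup.2.2 i hi i rfl rfl
    simp only [Arrangement.rankFrom, arrangement, hedge, tokens, h, Option.toList_some,
      List.idxOf_append_of_notMem hi]
    simp

theorem rank_get_onEdge {e : E} (k : Fin (F.onEdge e).length) {i : Fin n}
    (h : F.slotOf i = .inl ⟨e, k⟩) :
    (F.arrangement hov).rank i = (F.outerToken ov (e, false)).toList.length + k := by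
  have hi : (F.onEdge e)[(k : ℕ)] = i := Option.some_inj.1 (F.slotOf_eq_iff.1 h)
  have hlt : (F.outerToken ov (e, false)).toList.length + k < (F.tokens ov e).length := by
    simp only [tokens, List.length_append]
    omega
  have hget : (F.tokens ov e)[(F.outerToken ov (e, false)).toList.length + k] = i := by
    simp [tokens, hi]
  simp only [arrangement, h, slotEdge]
  rw [← hget, (F.nodup_tokens ov e).idxOf_getElem]

open Classical in
/-- The gaps at the ends of the edges of a configuration in the cube of a face. -/
noncomputable def endGap (s : F.Cube) (ov : V → G.OrientedEdge) (o : G.OrientedEdge) : ℝ :=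
  if (F.moving o).isSome then F.gap s o else if (F.outerToken ov o).isSome then 0 else 1

variable (s : F.Cube)

theorem isSome_outerToken_of_moving {o : G.OrientedEdge} (h : (F.moving o).isSome) :
    (F.outerToken ov o).isSome := by
  rw [outerToken, if_pos h]
  exact h

theorem isSome_outerToken_of_endGap_lt {o : G.OrientedEdge} (h : F.endGap s ov o < 1) :
    (F.outerToken ov o).isSome := by
  unfold endGap at h
  split_ifs at h with hmoving houter
  · exact F.isSome_outerToken_of_moving hmoving
  · exact houter
  · exact h.false.elim

theorem isGapFunction_endGap : IsGapFunction G (F.arrangement hov) (F.endGap s ov) where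
  nonneg o := by
    unfold endGap
    split_ifs
    exacts [F.gap_nonneg s o, le_rfl, zero_le_one]
  le_one o := by
    unfold endGap
    split_ifs with h
    · rw [gap, dif_pos h]
      exact sub_le_self 1 (s ⟨o, h⟩).2.1
    · exact zero_le_one
    · exact le_rfl
  branched o h := by
    obtain ⟨i, hi⟩ := Option.isSome_iff_exists.1 (F.isSome_outerToken_of_endGap_lt s h)
    simp only [outerToken_eq_some_iff, slotOf_eq_iff] at hi
    rcases hi with hi | ⟨hi, -⟩
    · exact F.moving_branched o (Option.isSome_of_eq_some hi)
    · exact F.atVertex_branched _ (Option.isSome_of_eq_some hi)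
  unique o o' h h' := by
    obtain ⟨i, hi⟩ := Option.isSome_iff_exists.1 (F.isSome_outerToken_of_endGap_lt s h)
    obtain ⟨j, hj⟩ := Option.isSome_iff_exists.1 (F.isSome_outerToken_of_endGap_lt s h')
    exact F.eq_of_outerToken_eq_some ov hi hj
  count_pos o h := by
    obtain ⟨i, hi⟩ := Option.isSome_iff_exists.1 (F.isSome_outerToken_of_endGap_lt s h)
    exact List.length_pos_of_mem (F.mem_tokens_of_outerToken ov hi)
  two_le e h h' := by
    obtain ⟨i, hi⟩ := Option.isSome_iff_exists.1 (F.isSome_outerToken_of_endGap_lt s h)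
    obtain ⟨j, hj⟩ := Option.isSome_iff_exists.1 (F.isSome_outerToken_of_endGap_lt s h')
    simp only [arrangement, tokens, hi, hj, List.length_append, Option.toList_some,
      List.length_singleton]
    omega

theorem margin_eq_endGap_add (o : G.OrientedEdge) :
    F.margin s o = F.endGap s ov o + (F.outerToken ov o).toList.length := by
  unfold margin endGap
  split_ifs with hmoving houter
  · obtain ⟨i, hi⟩ := Option.isSome_iff_exists.1 (F.isSome_outerToken_of_moving (ov := ov) hmoving)
    simp [hi]
  · obtain ⟨i, hi⟩ := Option.isSome_iff_exists.1 houter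
    simp [hi]
  · simp [Option.not_isSome_iff_eq_none.1 houter]

theorem units_eq_units_arrangement (e : E) :
    F.units s e = (F.arrangement hov).units (F.endGap s ov) e := by
  simp only [units, F.margin_eq_endGap_add (ov := ov), Arrangement.units, arrangement, tokens,
    List.length_append, Nat.cast_add]
  ring

theorem endDist_place_of_outerToken {o : G.OrientedEdge} {i : Fin n}
    (h : F.outerToken ov o = some i) :
    (endDist o.2 ((F.arrangement hov).place (F.endGap s ov) i).2 : ℝ) =
      F.endGap s ov o / F.units s o.1 := by
  rw [(F.isGapFunction_endGap hov s).endDist_place, F.rankFrom_of_outerToken hov h,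
    show (F.arrangement hov).edge i = o.1 from F.slotEdge_of_outerToken ov h, Nat.cast_zero,
    add_zero, F.units_eq_units_arrangement hov]

theorem endGap_of_atVertex (hov : Function.RightInverse ov G.head) {v : V} {i : Fin n}
    (h : F.slotOf i = .inr (.inl v)) :
    F.outerToken ov (ov v) = some i ∧ F.endGap s ov (ov v) = 0 := by
  have houter : F.outerToken ov (ov v) = some i :=
    (F.outerToken_eq_some_iff ov).2 (.inr (by rw [hov v]; exact ⟨h, rfl⟩))
  have hmoving : ¬ (F.moving (ov v)).isSome := by
    intro hmoving
    have hnone := F.atVertex_eq_none _ hmoving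
    rw [hov v] at hnone
    exact Option.some_ne_none i ((F.slotOf_eq_iff.1 h).symm.trans hnone)
  exact ⟨houter, by rw [endGap, if_neg hmoving, if_pos (Option.isSome_of_eq_some houter)]⟩

theorem chart_place_arrangement (i : Fin n) :
    G.chart ((F.arrangement hov).place (F.endGap s ov) i) = F.slotPoint s (F.slotOf i) := by
  have h := F.isGapFunction_endGap hov s
  have hedge : (F.arrangement hov).edge i = F.slotEdge ov (F.slotOf i) := rfl
  rcases hi : F.slotOf i with ⟨e, k⟩ | v | ⟨e, b⟩
  · rw [h.chart_place, hedge, F.rank_get_onEdge hov k hi, hi, slotEdge, slotPoint,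
      F.margin_eq_endGap_add (ov := ov), F.units_eq_units_arrangement hov]
    push_cast
    rw [add_assoc]
  · obtain ⟨houter, hzero⟩ := F.endGap_of_atVertex s hov hi
    have hdist := F.endDist_place_of_outerToken hov s houter
    rw [hzero, zero_div] at hdist
    rw [hi] at hedge
    rw [eq_endOf_of_endDist_eq_zero (o := ov v) hedge (Subtype.ext hdist), chart_endOf, hov v]
    rfl
  · have houter := (F.outerToken_eq_some_iff ov).2 (.inl hi)
    have hdist := F.endDist_place_of_outerToken hov s houter
    replace hedge : (F.arrangement hov).edge i = e := by rw [hedge, hi, slotEdge]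
    have hmoving : (F.moving (e, b)).isSome := Option.isSome_of_eq_some (F.slotOf_eq_iff.1 hi)
    rw [endGap, if_pos hmoving] at hdist
    cases b
    · change G.edgePoint _ _ = G.edgePoint e (F.gap s (e, false) / F.units s e)
      rw [← hdist, ← hedge]
      rfl
    · change G.edgePoint _ _ = G.edgePoint e (1 - F.gap s (e, true) / F.units s e)
      rw [← hdist, ← hedge, ← coe_endDist_not]
      rfl

end Face

theorem exists_lift_of_mem_cubeComplex [Fintype E] (hG : Function.Surjective G.head)
    {x : Conf n G.Point} (hx : x ∈ G.cubeComplex n) :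
    ∃ z : G.Lift n, z.conf = x ∧ z.spread = z := by
  obtain ⟨F, s, rfl⟩ := hx
  choose ov hov using hG
  exact ⟨(F.isGapFunction_endGap hov s).lift,
    Subtype.ext (funext (F.chart_place_arrangement hov s)), IsGapFunction.spread_lift _⟩

/-! ### Transport along the retraction -/

namespace Lift

variable [Fintype E]

/-- The position of `p` between the two neighbouring tokens of the retracted configuration, where
`0` stands for the token, or the end of the edge, before `p`, and `1` for the one after `p`. -/
noncomputable def fraction (z : G.Lift n) (p : E × unitInterval) : ℝ :=
  (p.2 - unitInterval.symm (nextDist true z.spread.1 z.spread.1 p)) /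
    (nextDist false z.spread.1 z.spread.1 p -
      unitInterval.symm (nextDist true z.spread.1 z.spread.1 p))

/-- The map of an edge to itself that takes the tokens of the retracted configuration to those of
the given one and is affine in between. -/
noncomputable def transport (z : G.Lift n) (p : E × unitInterval) : E × unitInterval :=
  (p.1, projIcc 0 1 zero_le_one (AffineMap.lineMap
    (unitInterval.symm (nextDist true z.spread.1 z.1 p) : ℝ)
    (nextDist false z.spread.1 z.1 p : ℝ) (z.fraction p)))

/-- The point `p` lies between a token at a free vertex and that vertex once the tokens have been
spread. Such points are not taken to the complement of the tokens by `transport`. -/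
def IsTrapped (z : G.Lift n) (p : E × unitInterval) : Prop :=
  ∃ (o : G.OrientedEdge) (i : Fin n), G.IsFree (G.head o) ∧ z.1 i = endOf o ∧ p.1 = o.1 ∧
    endDist o.2 p.2 < endDist o.2 (z.spread.1 i).2

variable {z z' : G.Lift n} {p p' : E × unitInterval}

theorem fraction_mem_Icc (z : G.Lift n) (p : E × unitInterval) : z.fraction p ∈ Icc (0 : ℝ) 1 := by
  have hlt := symm_nextDist_self_lt_nextDist_self z.spread.1 p
  have hle : (unitInterval.symm (nextDist true z.spread.1 z.spread.1 p) : ℝ) ≤ p.2 :=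
    symm_nextDist_self_le z.spread.1 p
  have hge : (p.2 : ℝ) ≤ nextDist false z.spread.1 z.spread.1 p :=
    endDist_le_nextDist_self (b := false)
  exact ⟨div_nonneg (by linarith) (by linarith), (div_le_one (by linarith)).2 (by linarith)⟩

theorem fraction_mem_Ioo (z : G.Lift n) (hp : (p.2 : ℝ) ∈ Ioo (0 : ℝ) 1) :
    z.fraction p ∈ Ioo (0 : ℝ) 1 := by
  have hleft : (unitInterval.symm (nextDist true z.spread.1 z.spread.1 p) : ℝ) < p.2 :=
    Subtype.coe_lt_coe.2 (symm_nextDist_self_lt z.spread.1 hp.1)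
  have hright : (p.2 : ℝ) < nextDist false z.spread.1 z.spread.1 p :=
    Subtype.coe_lt_coe.2 (endDist_lt_nextDist_self (b := false) hp.2)
  exact ⟨div_pos (by linarith) (by linarith), (div_lt_one (by linarith)).2 (by linarith)⟩

theorem coe_transport (z : G.Lift n) (p : E × unitInterval) :
    ((z.transport p).2 : ℝ) = AffineMap.lineMap
      (unitInterval.symm (nextDist true z.spread.1 z.1 p) : ℝ)
      (nextDist false z.spread.1 z.1 p : ℝ) (z.fraction p) :=
  congrArg Subtype.val (projIcc_of_mem zero_le_one ((convex_Icc (0 : ℝ) 1).lineMap_mem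
    (unitInterval.symm _).2 (nextDist false _ _ _).2 (z.fraction_mem_Icc p)))

theorem transport_endOf (z : G.Lift n) (o : G.OrientedEdge) : z.transport (endOf o) = endOf o := by
  have hone (y t : Fin n → E × unitInterval) : nextDist (!o.2) y t (endOf o) = 1 :=
    nextDist_eq_one fun j _ => unitInterval.le_one'.trans_eq (endDist_not_endOf o.1 o.2).symm
  refine Prod.ext rfl (Subtype.ext ?_)
  rw [coe_transport]
  have hlt := symm_nextDist_self_lt_nextDist_self z.spread.1 (endOf o)
  obtain ⟨e, _ | _⟩ := o
  · have h : nextDist true z.spread.1 z.spread.1 (endOf (e, false)) = 1 := hone _ _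
    have h' : nextDist true z.spread.1 z.1 (endOf (e, false)) = 1 := hone _ _
    have hfraction : z.fraction (endOf (e, false)) = 0 := by
      rw [fraction, h]
      simp [endOf]
    rw [hfraction, AffineMap.lineMap_apply_zero, h', unitInterval.symm_one]
    rfl
  · have h : nextDist false z.spread.1 z.spread.1 (endOf (e, true)) = 1 := hone _ _
    have h' : nextDist false z.spread.1 z.1 (endOf (e, true)) = 1 := hone _ _
    rw [h, Icc.coe_one] at hlt
    have hfraction : z.fraction (endOf (e, true)) = 1 := by
      rw [fraction, h]
      exact div_self (sub_pos.2 hlt).ne'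
    rw [hfraction, AffineMap.lineMap_apply_one, h']
    rfl

theorem transport_eq_self (hz : z.spread = z) (p : E × unitInterval) : z.transport p = p := by
  refine Prod.ext rfl (Subtype.ext ?_)
  have hlt := symm_nextDist_self_lt_nextDist_self z.1 p
  rw [coe_transport, fraction, hz, AffineMap.lineMap_apply_ring',
    div_mul_cancel₀ _ (sub_pos.2 hlt).ne', sub_add_cancel]

theorem transport_congr (hV : ∀ v, G.IsFree v ∨ G.IsBranched v) (h : z.conf = z'.conf)
    (p : E × unitInterval) : z.transport p = z'.transport p := by
  have hcases (j : Fin n) : (z.1 j = z'.1 j ∧ z.spread.1 j = z'.spread.1 j) ∨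
      ∃ o o', z.1 j = endOf o ∧ z.spread.1 j = endOf o ∧
        z'.1 j = endOf o' ∧ z'.spread.1 j = endOf o' := by
    by_cases hj : z.1 j = z'.1 j
    · exact .inl ⟨hj, spread_congr hV h hj⟩
    · obtain ⟨o, o', hz, hz', hhead, hb⟩ := exists_endOf_of_ne hV h hj
      exact .inr ⟨o, o', hz, z.spread_eq_endOf_iff.2 ⟨hb, hz⟩, hz',
        z'.spread_eq_endOf_iff.2 ⟨hhead ▸ hb, hz'⟩⟩
  have hself (b : Bool) : nextDist b z.spread.1 z.spread.1 p =
      nextDist b z'.spread.1 z'.spread.1 p :=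
    nextDist_congr fun j => (hcases j).imp (fun hj => ⟨hj.2, hj.2⟩)
      fun ⟨o, o', _, h₂, _, h₄⟩ => ⟨o, o', h₂, h₂, h₄, h₄⟩
  have hval (b : Bool) : nextDist b z.spread.1 z.1 p = nextDist b z'.spread.1 z'.1 p :=
    nextDist_congr fun j => (hcases j).imp And.symm
      fun ⟨o, o', h₁, h₂, h₃, h₄⟩ => ⟨o, o', h₂, h₁, h₄, h₃⟩
  simp only [transport, fraction, hself, hval]

theorem chart_transport_congr (hV : ∀ v, G.IsFree v ∨ G.IsBranched v) (h : z.conf = z'.conf)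
    (hp : G.chart p = G.chart p') : G.chart (z.transport p) = G.chart (z'.transport p') := by
  rcases eq_or_endOf_of_chart_eq hp with rfl | ⟨o, o', rfl, rfl, -⟩
  · rw [transport_congr hV h]
  · rw [transport_endOf, transport_endOf, hp]

theorem endDist_pos_of_not_isTrapped (hV : ∀ v, G.IsFree v ∨ G.IsBranched v) (h : ¬ z.IsTrapped p)
    {b : Bool} {j : Fin n} (hedge : (z.spread.1 j).1 = p.1)
    (hj : endDist b p.2 < endDist b (z.spread.1 j).2) : 0 < endDist b (z.1 j).2 := by
  refine unitInterval.pos_iff_ne_zero.2 fun hzero => ?_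
  have hend : z.1 j = endOf (p.1, b) := eq_endOf_of_endDist_eq_zero hedge hzero
  rcases hV (G.head (p.1, b)) with hfree | hb
  · exact h ⟨(p.1, b), j, hfree, hend, rfl, hj⟩
  · rw [z.spread_eq_endOf_iff.2 ⟨hb, hend⟩, endDist_endOf (p.1, b)] at hj
    exact not_lt_bot hj

theorem symm_nextDist_lt_nextDist (hV : ∀ v, G.IsFree v ∨ G.IsBranched v) (h : ¬ z.IsTrapped p) :
    unitInterval.symm (nextDist true z.spread.1 z.1 p) < nextDist false z.spread.1 z.1 p := by
  refine lt_nextDist ?_ fun j hj hjp => ?_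
  · rw [unitInterval.symm_lt_comm, unitInterval.symm_one]
    exact lt_nextDist zero_lt_one fun k hk hkp => endDist_pos_of_not_isTrapped hV h hk hkp
  · refine unitInterval.symm_lt_comm.1 (lt_nextDist (b := true) ?_ fun k hk hkp => ?_)
    · rw [unitInterval.symm_lt_comm, unitInterval.symm_one]
      exact endDist_pos_of_not_isTrapped hV h hj hjp
    · exact (z.endDist_spread_lt_endDist_spread true (hj.trans hk.symm)).1
        ((endDist_not_lt_endDist_not.2 hjp).trans hkp)

theorem endDist_transport_lt (hV : ∀ v, G.IsFree v ∨ G.IsBranched v) (h : ¬ z.IsTrapped p)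
    (hp : (p.2 : ℝ) ∈ Ioo (0 : ℝ) 1) (b : Bool) :
    endDist b (z.transport p).2 < nextDist b z.spread.1 z.1 p := by
  have hlt := Subtype.coe_lt_coe.2 (symm_nextDist_lt_nextDist hV h)
  obtain ⟨hpos, hone⟩ := z.fraction_mem_Ioo hp
  cases b
  · refine Subtype.coe_lt_coe.1 ?_
    change ((z.transport p).2 : ℝ) < _
    rw [coe_transport]
    exact (lineMap_lt_right_iff_lt hone).2 hlt
  · refine unitInterval.symm_lt_comm.1 (Subtype.coe_lt_coe.1 ?_)
    rw [coe_transport]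
    exact (left_lt_lineMap_iff_lt hpos).2 hlt

theorem chart_transport_endOf_ne (hV : ∀ v, G.IsFree v ∨ G.IsBranched v) {o : G.OrientedEdge}
    (hp : ∀ i, G.chart (endOf o) ≠ G.chart (z.spread.1 i)) (h : ¬ z.IsTrapped (endOf o))
    (i : Fin n) : G.chart (z.transport (endOf o)) ≠ G.chart (z.1 i) := by
  rw [transport_endOf]
  intro hc
  obtain ⟨o', hi, hhead⟩ : ∃ o', z.1 i = endOf o' ∧ G.head o = G.head o' := by
    rcases eq_or_endOf_of_chart_eq hc with hi | ⟨o₁, o', ho, hi, hhead⟩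
    · exact ⟨o, hi.symm, rfl⟩
    · exact ⟨o', hi, endOf_injective ho ▸ hhead⟩
  rcases hV (G.head o) with hfree | hb
  · obtain rfl : o = o' := hfree.eq_of_head rfl hhead.symm
    refine h ⟨o, i, hfree, hi, rfl, ?_⟩
    rw [endDist_endOf, unitInterval.pos_iff_ne_zero]
    intro hzero
    have hedge : (z.spread.1 i).1 = o.1 := congrArg Prod.fst hi
    exact hfree.not_isBranched
      (z.spread_eq_endOf_iff.1 (eq_endOf_of_endDist_eq_zero hedge hzero)).1
  · exact hp i (hc.trans (congrArg G.chart
      (hi.trans (z.spread_eq_endOf_iff.2 ⟨hhead ▸ hb, hi⟩).symm)))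

theorem chart_transport_ne (hV : ∀ v, G.IsFree v ∨ G.IsBranched v)
    (hp : ∀ i, G.chart p ≠ G.chart (z.spread.1 i)) (h : ¬ z.IsTrapped p) (i : Fin n) :
    G.chart (z.transport p) ≠ G.chart (z.1 i) := by
  rcases eq_endOf_or_mem_Ioo p with ⟨b, hend⟩ | hint
  · rw [hend] at hp h ⊢
    exact chart_transport_endOf_ne hV hp h i
  intro hc
  have hlt := endDist_transport_lt hV h hint
  have hint' : ((z.transport p).2 : ℝ) ∈ Ioo (0 : ℝ) 1 := by
    have htrue := unitInterval.symm_lt_comm.1 ((hlt true).trans_le unitInterval.le_one')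
    rw [unitInterval.symm_one] at htrue
    exact ⟨htrue, (hlt false).trans_le unitInterval.le_one'⟩
  have hi : z.transport p = z.1 i := eq_of_chart_eq_of_mem_Ioo hint' hc
  have hedge : (z.spread.1 i).1 = p.1 := (congrArg Prod.fst hi).symm
  have hne : p.2 ≠ (z.spread.1 i).2 := fun heq => hp i (congrArg G.chart (Prod.ext hedge.symm heq))
  obtain ⟨b, hb⟩ : ∃ b, endDist b p.2 < endDist b (z.spread.1 i).2 := by
    rcases hne.lt_or_gt with hlt | hgt
    · exact ⟨false, hlt⟩
    · exact ⟨true, unitInterval.symm_lt_symm.2 hgt⟩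
  exact (hlt b).not_ge (hi ▸ nextDist_le hedge hb)

theorem continuous_transport [TopologicalSpace E] [DiscreteTopology E]
    (S : Set (G.Lift n × (E × unitInterval))) (hS : ∀ w ∈ S, ∀ i, w.1.spread.1 i ≠ w.2) :
    Continuous fun w : S => w.1.1.transport w.1.2 := by
  have hp : Continuous fun w : S => w.1.2 := continuous_snd.comp continuous_subtype_val
  have ht : Continuous fun w : S => w.1.1.1 :=
    continuous_val.comp (continuous_fst.comp continuous_subtype_val)
  have hy : Continuous fun w : S => w.1.1.spread.1 :=
    continuous_val.comp (continuous_spread.comp (continuous_fst.comp continuous_subtype_val))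
  have hnext {t : S → Fin n → E × unitInterval} (ht : Continuous t) (b : Bool) :
      Continuous fun w : S => nextDist b w.1.1.spread.1 (t w) w.1.2 :=
    continuous_nextDist b hy ht hp fun j => .inr fun w => hS w.1 w.2 j
  have hleft {t : S → Fin n → E × unitInterval} (ht : Continuous t) : Continuous fun w : S =>
      (unitInterval.symm (nextDist true w.1.1.spread.1 (t w) w.1.2) : ℝ) :=
    continuous_subtype_val.comp (unitInterval.continuous_symm.comp (hnext ht true))
  have hright {t : S → Fin n → E × unitInterval} (ht : Continuous t) : Continuous fun w : S =>
      (nextDist false w.1.1.spread.1 (t w) w.1.2 : ℝ) :=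
    continuous_subtype_val.comp (hnext ht false)
  have hfraction : Continuous fun w : S => w.1.1.fraction w.1.2 :=
    ((continuous_subtype_val.comp (continuous_snd.comp hp)).sub (hleft hy)).div
      ((hright hy).sub (hleft hy))
      fun w => (sub_pos.2 (symm_nextDist_self_lt_nextDist_self _ _)).ne'
  exact (continuous_fst.comp hp).prodMk
    (continuous_projIcc.comp ((hleft ht).lineMap (hright ht) hfraction))

end Lift

/-! ### Extending identifying functions along the retraction -/

section Extension

variable [Fintype E]

/-- The retraction of the configuration space to the cube complex: the tokens are spread in
arbitrarily chosen edge coordinates. -/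
noncomputable def retract (hG : Function.Surjective G.head) (x : Conf n G.Point) :
    Conf n G.Point :=
  (Function.surjInv (Lift.conf_surjective hG) x).spread.conf

/-- The map `Lift.transport` in terms of points of the graph, with arbitrarily chosen edge
coordinates. It is applied to a configuration and a point different from all retracted tokens. -/
noncomputable def transportPoint (hG : Function.Surjective G.head)
    (w : Conf n G.Point × G.Point) : G.Point :=
  G.chart ((Function.surjInv (Lift.conf_surjective hG) w.1).transport
    (Function.surjInv (G.chart_surjective hG) w.2))

theorem retract_mem_cubeComplex (hG : Function.Surjective G.head) (x : Conf n G.Point) :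
    retract hG x ∈ G.cubeComplex n :=
  Lift.conf_spread_mem_cubeComplex _

section FreeOrBranched

variable (hV : ∀ v, G.IsFree v ∨ G.IsBranched v)
include hV

theorem retract_conf (z : G.Lift n) : retract (head_surjective hV) z.conf = z.spread.conf :=
  Lift.conf_spread_congr hV (Function.surjInv_eq _ _)

theorem transportPoint_conf_chart (z : G.Lift n) (p : E × unitInterval) :
    transportPoint (head_surjective hV) (z.conf, G.chart p) = G.chart (z.transport p) :=
  Lift.chart_transport_congr hV (Function.surjInv_eq _ _) (Function.surjInv_eq _ _)

theorem retract_eq_self {x : Conf n G.Point} (hx : x ∈ G.cubeComplex n) :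
    retract (head_surjective hV) x = x := by
  obtain ⟨z, rfl, hz⟩ := exists_lift_of_mem_cubeComplex (head_surjective hV) hx
  rw [retract_conf hV, hz]

theorem transportPoint_eq_self {x : Conf n G.Point} (hx : x ∈ G.cubeComplex n) (y : G.Point) :
    transportPoint (head_surjective hV) (x, y) = y := by
  obtain ⟨z, rfl, hz⟩ := exists_lift_of_mem_cubeComplex (head_surjective hV) hx
  obtain ⟨p, rfl⟩ := G.chart_surjective (head_surjective hV) y
  rw [transportPoint_conf_chart hV, z.transport_eq_self hz]

theorem continuous_retract : Continuous (retract (head_surjective hV) : Conf n G.Point → _) := by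
  let _ : TopologicalSpace E := ⊥
  have : DiscreteTopology E := ⟨rfl⟩
  refine (Lift.isQuotientMap_conf (head_surjective hV)).continuous_iff.2 ?_
  rw [show retract (head_surjective hV) ∘ Lift.conf = fun z : G.Lift n => z.spread.conf from
    funext (retract_conf hV)]
  exact Lift.isProperMap_conf.continuous.comp Lift.continuous_spread

theorem continuousOn_transportPoint :
    ContinuousOn (transportPoint (head_surjective hV))
      {w : Conf n G.Point × G.Point | ∀ i, w.2 ≠ (retract (head_surjective hV) w.1).1 i} := by
  let _ : TopologicalSpace E := ⊥
  have : DiscreteTopology E := ⟨rfl⟩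
  refine continuousOn_iff_continuous_domRestrict.2
    (continuous_of_continuous_comp_lift (head_surjective hV) _ _ ?_)
  have htransport := Lift.continuous_transport (Prod.map (Lift.conf : G.Lift n → _) G.chart ⁻¹'
    {w | ∀ i, w.2 ≠ (retract (head_surjective hV) w.1).1 i}) fun w hw i hi => hw i <| by
      rw [Prod.map_fst, Prod.map_snd, retract_conf hV, ← hi]
      rfl
  convert G.continuous_chart.comp htransport using 1
  exact funext fun w => transportPoint_conf_chart hV w.1.1 w.1.2

theorem extendsToConf_of_not_isTrapped {f : G.cubeComplex n → G.Point}
    (hf : IsIdentifyingOn (G.cubeComplex n) f)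
    (htrap : ∀ (z : G.Lift n) (p : E × unitInterval),
      f ⟨_, z.conf_spread_mem_cubeComplex⟩ = G.chart p → ¬ z.IsTrapped p) :
    ExtendsToConf (G.cubeComplex n) f := by
  have hG := head_surjective hV
  let r (x : Conf n G.Point) : G.cubeComplex n := ⟨retract hG x, retract_mem_cubeComplex hG x⟩
  have hr : Continuous r := (continuous_retract hV).subtype_mk _
  have hr_conf (z : G.Lift n) : r z.conf = ⟨_, z.conf_spread_mem_cubeComplex⟩ :=
    Subtype.ext (retract_conf hV z)
  have hr_self (x : G.cubeComplex n) : r x = x := Subtype.ext (retract_eq_self hV x.2)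
  have hcont : Continuous fun x : Conf n G.Point => transportPoint hG (x, f (r x)) :=
    (continuousOn_transportPoint hV).comp_continuous (continuous_id.prodMk (hf.1.comp hr))
      fun x i => hf.2 (r x) i
  have hne (x : Conf n G.Point) (i : Fin n) : transportPoint hG (x, f (r x)) ≠ x.1 i := by
    obtain ⟨z, rfl⟩ := Lift.conf_surjective hG x
    obtain ⟨p, hp⟩ := G.chart_surjective hG (f (r z.conf))
    rw [← hp, transportPoint_conf_chart hV]
    rw [hr_conf] at hp
    exact Lift.chart_transport_ne hV (fun j => hp ▸ hf.2 _ j) (htrap z p hp.symm) i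
  exact ⟨_, ⟨hcont, hne⟩, fun x => by rw [transportPoint_eq_self hV x.2, hr_self]⟩

end FreeOrBranched

end Extension

/-! ### Moving a token through a free edge -/

open Classical in
/-- The distance from the tail of `o`, extended by `0` to the points that are not on the edge of
`o`. It is only used if the head of `o` is a free vertex, where this extension is continuous. -/
noncomputable def tailDist (o : G.OrientedEdge) : G.Point → unitInterval
  | .vertex v => if v = G.head o then 1 else 0
  | .interior e t => if e = o.1 then endDist (!o.2) ⟨t, t.2.1.le, t.2.2.le⟩ else 0

theorem endOf_eq_endDist_one (o : G.OrientedEdge) : endOf o = (o.1, endDist (!o.2) 1) := by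
  rw [← endDist_not_endOf o.1 o.2, endDist_endDist]
  rfl

theorem endOf_not_eq_endDist_zero (o : G.OrientedEdge) :
    endOf (o.1, !o.2) = (o.1, endDist (!o.2) 0) := by
  rw [← endDist_endOf (o.1, !o.2), endDist_endDist]
  rfl

open Classical in
theorem tailDist_chart {o : G.OrientedEdge} (ho : G.IsFree (G.head o)) (p : E × unitInterval) :
    tailDist o (G.chart p) = if p.1 = o.1 then endDist (!o.2) p.2 else 0 := by
  rcases eq_endOf_or_mem_Ioo p with ⟨b, hp⟩ | hp
  · rw [hp, chart_endOf, tailDist, endOf_fst]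
    by_cases hhead : G.head (p.1, b) = G.head o
    · obtain rfl : (p.1, b) = o := ho.eq_of_head hhead rfl
      rw [if_pos rfl, if_pos rfl, endDist_not_endOf]
    · rw [if_neg hhead]
      refine (ite_eq_right_iff.2 fun hedge => ?_).symm
      have hb : b = !o.2 := by
        refine Bool.eq_not_of_ne fun hb => hhead ?_
        rw [hedge, hb]
      rw [hb]
      exact endDist_endOf (p.1, !o.2)
  · rw [chart_of_mem_Ioo _ hp, tailDist]

theorem eq_chart_of_tailDist_pos {o : G.OrientedEdge} {y : G.Point} (hy : 0 < tailDist o y) :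
    y = G.chart (o.1, endDist (!o.2) (tailDist o y)) := by
  rcases y with v | ⟨e, t⟩ <;> rw [tailDist] at hy ⊢ <;> split_ifs at hy ⊢ with h
  · rw [← endOf_eq_endDist_one, chart_endOf, h]
  · exact absurd hy (lt_irrefl _)
  · rw [endDist_endDist, ← h]
    exact (G.chart_of_mem_Ioo (p := (e, ⟨t, t.2.1.le, t.2.2.le⟩)) t.2).symm
  · exact absurd hy (lt_irrefl _)

theorem continuous_tailDist {o : G.OrientedEdge} (ho : G.IsFree (G.head o)) :
    Continuous (tailDist o) := by
  classical
  refine G.continuous_point_iff.2 fun e => ?_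
  rw [show (fun t : unitInterval => tailDist o (G.edgePoint e t)) =
    fun t => if e = o.1 then endDist (!o.2) t else 0 from funext fun t => tailDist_chart ho (e, t)]
  exact Continuous.if_const _ (continuous_endDist _) continuous_const

theorem exists_eq_chart_of_tailDist_pos {o : G.OrientedEdge} (ho : G.IsFree (G.head o))
    {y : unitInterval → G.Point} (hy : Continuous y) (h0 : 0 < tailDist o (y 0)) :
    ∃ t, y t = G.chart (o.1, endDist (!o.2) t) := by
  obtain ⟨t, ht⟩ : ∃ t, t = tailDist o (y t) :=
    intermediate_value_univ₂ continuous_id ((continuous_tailDist ho).comp hy) (a := 0) (b := 1)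
      unitInterval.nonneg' unitInterval.le_one'
  have hpos : 0 < tailDist o (y t) := by
    refine unitInterval.pos_iff_ne_zero.2 fun hzero => h0.ne' ?_
    rwa [ht.trans hzero] at hzero
  refine ⟨t, ?_⟩
  nth_rw 2 [ht]
  exact eq_chart_of_tailDist_pos hpos

theorem tailDist_pos_of_mem_closedEdge {o : G.OrientedEdge} (ho : G.IsFree (G.head o))
    {y : G.Point} (hy : y ∈ G.closedEdge o.1) (hne : y ≠ .vertex (G.head (o.1, !o.2))) :
    0 < tailDist o y := by
  obtain ⟨p, hp, rfl⟩ := G.closedEdge_eq_image_chart o.1 ▸ hy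
  rw [tailDist_chart ho, if_pos (show p.1 = o.1 from hp)]
  refine unitInterval.pos_iff_ne_zero.2 fun hzero => hne ?_
  rw [eq_endOf_of_endDist_eq_zero (o := (o.1, !o.2)) hp hzero, chart_endOf]

theorem injective_update_of_forall_ne {ι X : Type*} [DecidableEq ι] {f : ι → X}
    (hf : Function.Injective f) {i : ι} {a : X} (ha : ∀ j, j ≠ i → f j ≠ a) :
    Function.Injective (Function.update f i a) := by
  intro j k hjk
  rcases eq_or_ne j i with rfl | hj <;> rcases eq_or_ne k j with rfl | hk
  · rfl
  · rw [Function.update_self, Function.update_of_ne hk] at hjk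
    exact absurd hjk.symm (ha k hk)
  · rfl
  · rcases eq_or_ne k i with rfl | hki
    · rw [Function.update_self, Function.update_of_ne hj] at hjk
      exact absurd hjk (ha j hj)
    · rw [Function.update_of_ne hj, Function.update_of_ne hki] at hjk
      exact hf hjk

theorem isEndpoint_iff_exists_head {v : V} {e : E} :
    G.IsEndpoint v e ↔ ∃ b, G.head (e, b) = v := by
  simp [IsEndpoint, head]

namespace Face

variable {F : G.Face n}

theorem vertexConf_of_atVertex {v : V} {i : Fin n} (hi : F.atVertex v = some i) :
    F.vertexConf.1 i = .vertex v := by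
  change F.slotPoint _ (F.slotOf i) = _
  rw [show F.slotOf i = .inr (.inl v) from F.slotOf_eq_iff.2 hi]
  rfl

theorem moving_eq_none [Finite E] (hF : F.dim = 0) (o : G.OrientedEdge) : F.moving o = none := by
  have hempty : IsEmpty {o : G.OrientedEdge // (F.moving o).isSome} :=
    (Nat.card_eq_zero.1 hF).resolve_right (not_infinite_iff_finite.2 inferInstance)
  by_contra hc
  exact hempty.false ⟨o, Option.isSome_iff_ne_none.2 hc⟩

theorem vertexConf_eq_vertex_or_interior [Finite E] (hF : F.dim = 0) (j : Fin n) :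
    (∃ v, F.atVertex v = some j ∧ F.vertexConf.1 j = .vertex v) ∨
      ∃ e t, j ∈ F.onEdge e ∧ F.vertexConf.1 j = .interior e t := by
  have hlabel := F.label_slotOf j
  have hconf : F.vertexConf.1 j = F.slotPoint _ (F.slotOf j) := rfl
  rcases hslot : F.slotOf j with c | v | o <;> rw [hslot] at hlabel hconf
  · obtain ⟨_, hc⟩ := F.slotPoint_inl (fun _ => 0) c
    exact .inr ⟨c.1, _, Option.some_inj.1 hlabel ▸ List.get_mem _ c.2, hconf.trans hc⟩
  · exact .inl ⟨v, hlabel, hconf⟩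
  · exact absurd ((F.moving_eq_none hF o).symm.trans hlabel) (Option.some_ne_none j).symm

theorem vertexConf_notMem_closedEdge [Finite E] (hF : F.dim = 0) {o : G.OrientedEdge}
    (ho : G.IsFree (G.head o)) {i j : Fin n} (hi : F.atVertex (G.head (o.1, !o.2)) = some i)
    (hedge : F.onEdge o.1 = []) (hij : j ≠ i) : F.vertexConf.1 j ∉ G.closedEdge o.1 := by
  rw [closedEdge_eq_image_chart]
  rintro ⟨⟨_, t⟩, rfl, hj⟩
  rcases vertexConf_eq_vertex_or_interior hF j with ⟨v, hv, hjv⟩ | ⟨e, s, hje, hjs⟩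
  · rw [hjv] at hj
    rcases eq_endOf_or_mem_Ioo (o.1, t) with ⟨b, hend⟩ | hint
    · rw [hend, chart_endOf] at hj
      obtain rfl := Point.vertex.inj hj
      rcases Bool.eq_or_eq_not b o.2 with rfl | rfl
      · exact ho.not_isBranched (F.atVertex_branched _ (Option.isSome_of_eq_some hv))
      · exact hij (Option.some_inj.1 (hv.symm.trans hi))
    · rw [chart_of_mem_Ioo _ hint] at hj
      cases hj
  · rw [hjs] at hj
    rcases eq_endOf_or_mem_Ioo (o.1, t) with ⟨b, hend⟩ | hint
    · rw [hend, chart_endOf] at hj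
      cases hj
    · rw [chart_of_mem_Ioo _ hint] at hj
      rw [← (Point.interior.inj hj).1, hedge] at hje
      exact List.not_mem_nil hje

end Face

/-- Otherwise, moving the token `F(v)` through the free edge to its free end would make it collide
with the value of the extension, which starts on that edge. -/
theorem isExtendable_of_extendsToConf [Finite E] {A : Set (Conf n G.Point)}
    (hA : G.zeroSkeleton n ⊆ A) {f : A → G.Point} (hf : ExtendsToConf A f) :
    IsExtendable A hA f := by
  rintro ⟨e, u, v, F, hF, hue, hu, hve, hv, hFv, hedge, hfe⟩
  obtain ⟨b, rfl⟩ := isEndpoint_iff_exists_head.1 hue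
  obtain ⟨b', rfl⟩ := isEndpoint_iff_exists_head.1 hve
  obtain rfl : b' = !b := by
    refine Bool.eq_not_of_ne fun hb => hu.not_isBranched ?_
    rwa [← hb]
  obtain ⟨i, hi⟩ := Option.isSome_iff_exists.1 hFv
  obtain ⟨g, ⟨hg, hgne⟩, hgf⟩ := hf
  let token (t : unitInterval) : G.Point := G.chart (e, endDist (!b) t)
  have htoken : Continuous token := (G.continuous_edgePoint e).comp (continuous_endDist _)
  have htoken0 : token 0 = F.vertexConf.1 i := by
    rw [Face.vertexConf_of_atVertex hi, ← chart_endOf]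
    exact congrArg G.chart (endOf_not_eq_endDist_zero (G := G) (e, b)).symm
  have hinj (t : unitInterval) :
      Function.Injective (Function.update F.vertexConf.1 i (token t)) :=
    injective_update_of_forall_ne F.vertexConf.2 fun j hj heq =>
      Face.vertexConf_notMem_closedEdge hF hu hi hedge hj (heq ▸ G.chart_mem_closedEdge e _)
  let x (t : unitInterval) : Conf n G.Point := ⟨_, hinj t⟩
  have hx : Continuous x := (continuous_const.update i htoken).subtype_mk _
  have hxi (t : unitInterval) : (x t).1 i = token t := Function.update_self ..
  have hx0 : x 0 = F.vertexConf :=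
    Subtype.ext (by rw [← Function.update_eq_self i F.vertexConf.1, ← htoken0])
  have hpos : 0 < tailDist (e, b) (g (x 0)) := by
    have hgF : g F.vertexConf = f ⟨F.vertexConf, hA ⟨F, hF, rfl⟩⟩ := hgf ⟨_, _⟩
    have hne : g F.vertexConf ≠ .vertex (G.head (e, !b)) :=
      Face.vertexConf_of_atVertex hi ▸ hgne F.vertexConf i
    rw [hx0]
    exact tailDist_pos_of_mem_closedEdge hu (by rwa [hgF]) hne
  obtain ⟨t, ht⟩ := exists_eq_chart_of_tailDist_pos hu (hg.comp hx) hpos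
  exact hgne (x t) i (ht.trans (hxi t).symm)

/-! ### Passed tokens -/

theorem lt_iff_lt_of_forall_ne {X α : Type*} [TopologicalSpace X] [PreconnectedSpace X]
    [LinearOrder α] [TopologicalSpace α] [OrderClosedTopology α] {f g : X → α} (hf : Continuous f)
    (hg : Continuous g) (hne : ∀ x, f x ≠ g x) (a b : X) : f a < g a ↔ f b < g b := by
  have himp {a b : X} (ha : f a < g a) : f b < g b := by
    by_contra! hb
    obtain ⟨x, hx⟩ := intermediate_value_univ₂ hf hg ha.le hb
    exact hne x hx
  exact ⟨himp, himp⟩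

/-- The lifted configurations that represent points of the cube complex. -/
abbrev CubeLift (G : CellGraph V E) (n : ℕ) : Type _ := {z : G.Lift n // z.conf ∈ G.cubeComplex n}

/-- The point of the cube complex with a given lift. -/
noncomputable def CubeLift.conf (z : G.CubeLift n) : G.cubeComplex n := ⟨z.1.conf, z.2⟩

/-- At the configuration `z`, the value of `f` lies on the edge of `o`, between its token `l` and
the head of `o`. It is only used for oriented edges `o` that point to a free vertex. -/
def IsPassed (f : G.cubeComplex n → G.Point) (o : G.OrientedEdge) (l : Fin n) (z : G.CubeLift n) :
    Prop :=
  endDist (!o.2) (z.1.1 l).2 < tailDist o (f z.conf)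

theorem isPassed_congr {f : G.cubeComplex n → G.Point} {o : G.OrientedEdge} {l : Fin n}
    {z z' : G.CubeLift n} (hconf : z.1.conf = z'.1.conf) (hl : z.1.1 l = z'.1.1 l) :
    IsPassed f o l z ↔ IsPassed f o l z' := by
  rw [IsPassed, IsPassed, hl, show z.conf = z'.conf from Subtype.ext hconf]

theorem CubeLift.continuous_conf [TopologicalSpace E] [DiscreteTopology E] [Finite E] :
    Continuous (conf : G.CubeLift n → _) :=
  (Lift.isProperMap_conf.continuous.comp continuous_subtype_val).subtype_mk _

theorem tailDist_ne {f : G.cubeComplex n → G.Point} (hf : IsIdentifyingOn (G.cubeComplex n) f)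
    {o : G.OrientedEdge} {l : Fin n} {z : G.CubeLift n} (hl : (z.1.1 l).1 = o.1)
    (hpos : 0 < endDist (!o.2) (z.1.1 l).2) :
    endDist (!o.2) (z.1.1 l).2 ≠ tailDist o (f z.conf) := by
  intro heq
  refine hf.2 z.conf l ((eq_chart_of_tailDist_pos (heq ▸ hpos)).trans ?_)
  rw [← heq, endDist_endDist, ← hl]
  rfl

theorem isPassed_iff_of_path [Finite E] [TopologicalSpace E] [DiscreteTopology E]
    {f : G.cubeComplex n → G.Point} (hf : IsIdentifyingOn (G.cubeComplex n) f)
    {o : G.OrientedEdge} (ho : G.IsFree (G.head o)) {l : Fin n} {z : unitInterval → G.CubeLift n}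
    (hz : Continuous z) (hl : ∀ t, ((z t).1.1 l).1 = o.1)
    (hpos : ∀ t, 0 < endDist (!o.2) ((z t).1.1 l).2) (s t : unitInterval) :
    IsPassed f o l (z s) ↔ IsPassed f o l (z t) :=
  lt_iff_lt_of_forall_ne
    ((continuous_endDist _).comp (continuous_snd.comp
      ((Lift.continuous_apply l).comp (continuous_subtype_val.comp hz))))
    ((continuous_tailDist ho).comp (hf.1.comp (CubeLift.continuous_conf.comp hz)))
    (fun t => tailDist_ne hf (hl t) (hpos t)) s t

namespace IsGapFunction

variable {A : Arrangement E n} {γ : G.OrientedEdge → ℝ}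

/-- The lift of a point of the cube complex with given arrangement and gaps. -/
noncomputable def cubeLift (h : IsGapFunction G A γ) : G.CubeLift n :=
  ⟨h.lift, h.conf_lift_mem_cubeComplex⟩

theorem one (G : CellGraph V E) (A : Arrangement E n) : IsGapFunction G A 1 where
  nonneg _ := zero_le_one
  le_one _ := le_rfl
  branched _ h := absurd h (lt_irrefl _)
  unique _ _ h := absurd h (lt_irrefl _)
  count_pos _ h := absurd h (lt_irrefl _)
  two_le _ h := absurd h (lt_irrefl _)

open Classical in
theorem update_one_zero {o : G.OrientedEdge} (hb : G.IsBranched (G.head o))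
    (hA : 0 < A.count o.1) : IsGapFunction G A (Function.update 1 o 0) := by
  have heq {o' : G.OrientedEdge} (h : Function.update (1 : G.OrientedEdge → ℝ) o 0 o' < 1) :
      o' = o := by
    by_contra hne
    rw [Function.update_of_ne hne] at h
    exact lt_irrefl _ h
  have hmem (o' : G.OrientedEdge) :
      Function.update (1 : G.OrientedEdge → ℝ) o 0 o' ∈ Icc (0 : ℝ) 1 := by
    rw [Function.update_apply]
    split_ifs <;> simp
  refine ⟨fun o' => (hmem o').1, fun o' => (hmem o').2, fun o' h => heq h ▸ hb,
    fun o₁ o₂ h₁ h₂ _ => (heq h₁).trans (heq h₂).symm, fun o' h => heq h ▸ hA, fun e h₁ h₂ => ?_⟩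
  have := (heq h₁).trans (heq h₂).symm
  simp at this

theorem lineMap (h : IsGapFunction G A γ) (t : unitInterval) :
    IsGapFunction G A (AffineMap.lineMap 1 γ (t : ℝ)) := by
  have hlt {o : G.OrientedEdge}
      (ho : AffineMap.lineMap (1 : G.OrientedEdge → ℝ) γ (t : ℝ) o < 1) : γ o < 1 := by
    refine (h.le_one o).lt_of_ne fun hone => ho.ne ?_
    rw [AffineMap.pi_lineMap_apply, hone, Pi.one_apply, AffineMap.lineMap_same_apply]
  have hmem (o : G.OrientedEdge) :
      AffineMap.lineMap (1 : G.OrientedEdge → ℝ) γ (t : ℝ) o ∈ Icc (0 : ℝ) 1 := by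
    rw [AffineMap.pi_lineMap_apply]
    exact (convex_Icc 0 1).lineMap_mem ⟨zero_le_one, le_rfl⟩ ⟨h.nonneg o, h.le_one o⟩ t.2
  exact ⟨fun o => (hmem o).1, fun o => (hmem o).2, fun o ho => h.branched o (hlt ho),
    fun o o' ho ho' => h.unique o o' (hlt ho) (hlt ho'),
    fun o ho => h.count_pos o (hlt ho), fun e ho ho' => h.two_le e (hlt ho) (hlt ho')⟩

theorem cubeLift_lineMap_zero (h : IsGapFunction G A γ) :
    (h.lineMap 0).cubeLift = (one G A).cubeLift :=
  Subtype.ext (Subtype.ext (congrArg A.place (AffineMap.lineMap_apply_zero _ _)))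

theorem cubeLift_lineMap_one (h : IsGapFunction G A γ) : (h.lineMap 1).cubeLift = h.cubeLift :=
  Subtype.ext (Subtype.ext (congrArg A.place (AffineMap.lineMap_apply_one _ _)))

theorem continuous_cubeLift_lineMap [TopologicalSpace E] (h : IsGapFunction G A γ) :
    Continuous fun t => (h.lineMap t).cubeLift := by
  have hgap (o : G.OrientedEdge) : Continuous fun t : unitInterval =>
      AffineMap.lineMap (1 : G.OrientedEdge → ℝ) γ (t : ℝ) o :=
    (continuous_apply o).comp (AffineMap.lineMap_continuous.comp continuous_subtype_val)
  refine Continuous.subtype_mk (Continuous.subtype_mk (continuous_pi fun i => ?_) _) _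
  have hunits : Continuous fun t : unitInterval =>
      A.units (AffineMap.lineMap (1 : G.OrientedEdge → ℝ) γ (t : ℝ)) (A.edge i) :=
    (((hgap _).add (hgap _)).add continuous_const).sub continuous_const
  exact continuous_const.prodMk (continuous_projIcc.comp
    (((hgap _).add continuous_const).div hunits fun t => ((h.lineMap t).units_pos _).ne'))

theorem endDist_cubeLift_lineMap_pos (h : IsGapFunction G A γ) {t : unitInterval} (ht : t < 1)
    (b : Bool) (l : Fin n) : 0 < endDist b ((h.lineMap t).cubeLift.1.1 l).2 := by
  have hgap : 0 < AffineMap.lineMap (1 : G.OrientedEdge → ℝ) γ (t : ℝ) (A.edge l, b) := by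
    rw [AffineMap.pi_lineMap_apply, AffineMap.lineMap_apply_ring, Pi.one_apply]
    have := mul_nonneg t.2.1 (h.nonneg (A.edge l, b))
    have : (t : ℝ) < 1 := ht
    linarith
  refine Subtype.coe_lt_coe.1 (((h.lineMap t).endDist_place b l).symm ▸ ?_)
  have := (h.lineMap t).units_pos (A.edge l)
  rw [Icc.coe_zero]
  positivity

section Passed

variable [Finite E] {f : G.cubeComplex n → G.Point} (hf : IsIdentifyingOn (G.cubeComplex n) f)
  {o : G.OrientedEdge} (ho : G.IsFree (G.head o)) {l : Fin n}

include hf ho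

/-- Along the path from even gaps to the gaps `γ`, the value of `f` never meets the token. -/
theorem isPassed_cubeLift_iff (h : IsGapFunction G A γ) (hl : A.edge l = o.1)
    (hpos : 0 < endDist (!o.2) (h.lift.1 l).2) :
    IsPassed f o l h.cubeLift ↔ IsPassed f o l (one G A).cubeLift := by
  let _ : TopologicalSpace E := ⊥
  have : DiscreteTopology E := ⟨rfl⟩
  have hpos' (t : unitInterval) : 0 < endDist (!o.2) ((h.lineMap t).cubeLift.1.1 l).2 := by
    rcases (show t ≤ 1 from unitInterval.le_one').lt_or_eq with ht | rfl
    · exact h.endDist_cubeLift_lineMap_pos ht _ l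
    · rw [h.cubeLift_lineMap_one]
      exact hpos
  rw [← h.cubeLift_lineMap_one, ← h.cubeLift_lineMap_zero]
  exact isPassed_iff_of_path hf ho h.continuous_cubeLift_lineMap (fun _ => hl) hpos' 1 0

theorem apply_mem_closedEdge_of_isPassed (h : IsGapFunction G A γ) (hl : A.edge l = o.1)
    (hpass : IsPassed f o l (one G A).cubeLift) : f h.cubeLift.conf ∈ G.closedEdge o.1 := by
  let _ : TopologicalSpace E := ⊥
  have : DiscreteTopology E := ⟨rfl⟩
  let path (t : unitInterval) : G.Point := f (h.lineMap t).cubeLift.conf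
  have hpath : Continuous path :=
    hf.1.comp (CubeLift.continuous_conf.comp h.continuous_cubeLift_lineMap)
  have hinit : Iio 1 ⊆ path ⁻¹' G.closedEdge o.1 := by
    intro t ht
    have hpos := h.endDist_cubeLift_lineMap_pos ht (!o.2) l
    have hpass' := ((h.lineMap t).isPassed_cubeLift_iff hf ho hl hpos).2 hpass
    change f (h.lineMap t).cubeLift.conf ∈ G.closedEdge o.1
    rw [eq_chart_of_tailDist_pos (hpos.trans hpass')]
    exact G.chart_mem_closedEdge o.1 _
  have hclosure := ((G.isClosed_closedEdge o.1).preimage hpath).closure_subset_iff.2 hinit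
  rw [closure_Iio' ⟨0, zero_lt_one⟩] at hclosure
  rw [← h.cubeLift_lineMap_one]
  exact hclosure (self_mem_Iic (a := (1 : unitInterval)))

end Passed

end IsGapFunction

/-! ### Emptying a free edge -/

theorem Lift.exists_conf_eq_and_eq_update {z : G.Lift n} {i : Fin n} {o o' : G.OrientedEdge}
    (hi : z.1 i = endOf o) (ho : G.head o = G.head o') :
    ∃ z' : G.Lift n, z'.conf = z.conf ∧ z'.1 = Function.update z.1 i (endOf o') := by
  have hchart : G.chart ∘ Function.update z.1 i (endOf o') = G.chart ∘ z.1 := by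
    rw [Function.comp_update, chart_endOf, ← ho, ← chart_endOf, ← hi]
    exact Function.update_eq_self i _
  exact ⟨⟨_, hchart ▸ z.2⟩, Subtype.ext hchart, rfl⟩

theorem fst_ne_of_isBranched_head {o o' : G.OrientedEdge} (ho : G.IsFree (G.head o))
    (hb : G.IsBranched (G.head o')) (hne : o' ≠ (o.1, !o.2)) : o'.1 ≠ o.1 := by
  intro hedge
  refine hne (Prod.ext hedge (Bool.eq_not_of_ne fun hend => ho.not_isBranched ?_))
  rwa [← show o' = o from Prod.ext hedge hend]

variable {A : Arrangement E n} {o : G.OrientedEdge} {l : Fin n}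

/-- The token at the branched end of a free edge can be regarded as a token on another edge with
the same end. -/
theorem IsGapFunction.exists_conf_eq_and_count_lt [Fintype E]
    (hV : ∀ v, G.IsFree v ∨ G.IsBranched v) (ho : G.IsFree (G.head o))
    {γ : G.OrientedEdge → ℝ} (h : IsGapFunction G A γ)
    (hb : G.IsBranched (G.head (o.1, !o.2))) (hγ : γ (o.1, !o.2) = 0) (hl : A.edge l = o.1)
    (hfirst : A.rankFrom (!o.2) l ≠ 0) (hlast : A.rankFrom o.2 l = 0) :
    ∃ z : G.Lift n, z.conf = h.lift.conf ∧ z.spread = z ∧ z.1 l = h.lift.1 l ∧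
      z.arrangement.count o.1 < A.count o.1 ∧ z.arrangement.rankFrom o.2 l = 0 := by
  obtain ⟨i, hi, hifirst⟩ := (A.bijOn_rankFrom (!o.2) o.1).surjOn
    (mem_Iio.2 (hl ▸ pos_of_gt (A.rank_lt_count l)))
  have hli : l ≠ i := fun hli => hfirst (hli ▸ hifirst)
  have hend : h.lift.1 i = endOf (o.1, !o.2) := h.place_eq_endOf_iff.2 ⟨hi, hγ, hifirst⟩
  obtain ⟨o', hhead, hne⟩ := hb.exists_ne (o.1, !o.2)
  have hedge : o'.1 ≠ o.1 := fst_ne_of_isBranched_head ho (hhead ▸ hb) hne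
  obtain ⟨z, hconf, hz⟩ := Lift.exists_conf_eq_and_eq_update hend hhead.symm
  have hzi : (z.1 i).1 ≠ o.1 := by rwa [hz, Function.update_self]
  have hzj {j : Fin n} (hj : j ≠ i) : z.1 j = h.lift.1 j := by rw [hz, Function.update_of_ne hj]
  have hzedge {j : Fin n} (hj : (z.1 j).1 = o.1) : z.1 j = h.lift.1 j :=
    hzj fun hji => hzi (hji ▸ hj)
  have hzl : (z.1 l).1 = o.1 := (congrArg Prod.fst (hzj hli)).trans hl
  refine ⟨z, hconf, Lift.spread_eq_of_conf_eq hV hconf.symm h.spread_lift, hzj hli, ?_,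
    (z.rankFrom_eq_zero_iff o.2).2 fun j hj => ?_⟩
  · rw [← z.arrangement.ncard_edge_eq, ← A.ncard_edge_eq]
    exact ncard_lt_ncard ⟨fun j hj => (congrArg Prod.fst (hzedge hj)).symm.trans hj,
      fun hsub => hzi (hsub hi)⟩
  · rw [hzj hli, hzedge (hj.trans hzl)]
    refine (h.lift.rankFrom_eq_zero_iff o.2).1 (h.arrangement_lift.symm ▸ hlast) j ?_
    rw [← hzj hli, ← hzedge (hj.trans hzl)]
    exact hj

section Passed

variable [Finite E] {f : G.cubeComplex n → G.Point} (hf : IsIdentifyingOn (G.cubeComplex n) f)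
  (ho : G.IsFree (G.head o)) (hb : G.IsBranched (G.head (o.1, !o.2)))

include hf ho hb

theorem IsPassed.exists_count_lt (hV : ∀ v, G.IsFree v ∨ G.IsBranched v) (hl : A.edge l = o.1)
    (hfirst : A.rankFrom (!o.2) l ≠ 0) (hlast : A.rankFrom o.2 l = 0)
    (hpass : IsPassed f o l (IsGapFunction.one G A).cubeLift) :
    ∃ B : Arrangement E n, B.count o.1 < A.count o.1 ∧ B.edge l = o.1 ∧ B.rankFrom o.2 l = 0 ∧
      IsPassed f o l (IsGapFunction.one G B).cubeLift := by
  classical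
  cases nonempty_fintype E
  have h := IsGapFunction.update_one_zero (A := A) hb (hl ▸ pos_of_gt (A.rank_lt_count l))
  have hpos : 0 < endDist (!o.2) (h.lift.1 l).2 := unitInterval.pos_iff_ne_zero.2 fun hzero =>
    hfirst (h.place_eq_endOf_iff.1 (eq_endOf_of_endDist_eq_zero (o := (o.1, !o.2)) hl hzero)).2.2
  obtain ⟨z, hconf, hz, hzl, hcount, hzlast⟩ :=
    h.exists_conf_eq_and_count_lt hV ho hb (Function.update_self ..) hl hfirst hlast
  have hlift : z.isGapFunction_gap.lift = z := hz
  have hzedge : z.arrangement.edge l = o.1 := (congrArg Prod.fst hzl).trans hl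
  refine ⟨z.arrangement, hcount, hzedge, hzlast,
    (z.isGapFunction_gap.isPassed_cubeLift_iff hf ho hzedge ?_).1
      ((isPassed_congr ?_ ?_).1 ((h.isPassed_cubeLift_iff hf ho hl hpos).2 hpass))⟩
  · rwa [hlift, hzl]
  · exact hconf.symm.trans (congrArg Lift.conf hlift).symm
  · exact hzl.symm.trans (congrArg (fun w : G.Lift n => w.1 l) hlift).symm

theorem IsPassed.not_isExtendable (hl : A.edge l = o.1) (hfirst : A.rankFrom (!o.2) l = 0)
    (hlast : A.rankFrom o.2 l = 0) (hpass : IsPassed f o l (IsGapFunction.one G A).cubeLift) :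
    ¬ IsExtendable (G.cubeComplex n) (G.zeroSkeleton_subset n) f := by
  classical
  have hcount : A.count o.1 = 1 := by
    rw [← hl, ← A.rankFrom_not_add_rankFrom_add_one o.2 l, hfirst, hlast]
  have h := IsGapFunction.update_one_zero (A := A) hb (hcount ▸ zero_lt_one)
  have hγ (o' : G.OrientedEdge) : Function.update (1 : G.OrientedEdge → ℝ) (o.1, !o.2) 0 o' = 0 ∨
      Function.update (1 : G.OrientedEdge → ℝ) (o.1, !o.2) 0 o' = 1 := by
    rw [Function.update_apply]
    split_ifs <;> simp
  have houter : outerCount (Function.update (1 : G.OrientedEdge → ℝ) (o.1, !o.2) 0)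
      (o.1, !o.2) = 1 := if_pos (by simp)
  refine not_not.2 ⟨o.1, G.head o, G.head (o.1, !o.2), h.face, h.dim_face hγ,
    isEndpoint_iff_exists_head.2 ⟨_, rfl⟩, ho, isEndpoint_iff_exists_head.2 ⟨_, rfl⟩, hb,
    ?_, ?_, ?_⟩
  · exact Option.isSome_iff_exists.2 ⟨l, h.vertexToken_eq_some_iff.2
      ⟨(o.1, !o.2), ⟨hl, hfirst, by simp⟩, Function.update_self .., rfl⟩⟩
  · refine List.eq_nil_of_length_eq_zero ((A.length_innerList _ _).trans ?_)
    cases hend : o.2 <;> rw [hend] at houter <;> simp only [Bool.not_false, Bool.not_true] at * <;>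
      omega
  · convert h.apply_mem_closedEdge_of_isPassed hf ho hl hpass using 3
    exact h.vertexConf_face hγ

theorem not_isPassed_one (hV : ∀ v, G.IsFree v ∨ G.IsBranched v)
    (hext : IsExtendable (G.cubeComplex n) (G.zeroSkeleton_subset n) f) (hl : A.edge l = o.1)
    (hlast : A.rankFrom o.2 l = 0) : ¬ IsPassed f o l (IsGapFunction.one G A).cubeLift := by
  intro hpass
  induction hm : A.count o.1 using Nat.strong_induction_on generalizing A with
  | _ m ih =>
  by_cases hfirst : A.rankFrom (!o.2) l = 0
  · exact hpass.not_isExtendable hf ho hb hl hfirst hlast hext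
  · obtain ⟨B, hcount, hBl, hBlast, hBpass⟩ := hpass.exists_count_lt hf ho hb hV hl hfirst hlast
    exact ih _ (hm ▸ hcount) hBl hBlast hBpass rfl

end Passed

theorem extendsToConf_of_isExtendable [Finite E] (hV : ∀ v, G.IsFree v ∨ G.IsBranched v)
    (hE : ∀ e b, G.IsFree (G.head (e, b)) → G.IsBranched (G.head (e, !b)))
    {f : G.cubeComplex n → G.Point} (hf : IsIdentifyingOn (G.cubeComplex n) f)
    (hext : IsExtendable (G.cubeComplex n) (G.zeroSkeleton_subset n) f) :
    ExtendsToConf (G.cubeComplex n) f := by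
  cases nonempty_fintype E
  refine extendsToConf_of_not_isTrapped hV hf ?_
  rintro z p hfp ⟨o, i, ho, hi, hp, hlt⟩
  have hedge : z.arrangement.edge i = o.1 := congrArg Prod.fst hi
  have hpos : 0 < endDist (!o.2) (z.spread.1 i).2 := by
    refine unitInterval.pos_iff_ne_zero.2 fun hzero => ?_
    have hend := (z.spread_eq_endOf_iff.1
      (eq_endOf_of_endDist_eq_zero (o := (o.1, !o.2)) hedge hzero)).2
    exact Bool.not_ne_self o.2 (congrArg Prod.snd (endOf_injective (hi.symm.trans hend))).symm
  have hpass : IsPassed f o i z.isGapFunction_gap.cubeLift :=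
    calc endDist (!o.2) (z.spread.1 i).2 < endDist (!o.2) p.2 := endDist_not_lt_endDist_not.2 hlt
      _ = tailDist o (f ⟨_, z.conf_spread_mem_cubeComplex⟩) := by
        rw [hfp, tailDist_chart ho, if_pos hp]
  exact not_isPassed_one hf ho (hE _ _ ho) hV hext hedge (z.rankFrom_eq_zero_of_eq_endOf hi)
    ((z.isGapFunction_gap.isPassed_cubeLift_iff hf ho hedge hpos).1 hpass)

/-! ### Connected graphs -/

theorem isClopen_singleton_vertex {v : V} (hv : ∀ o, G.head o ≠ v) :
    IsClopen ({.vertex v} : Set G.Point) := by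
  have hpreimage (e : E) :
      {t : unitInterval | G.edgePoint e t ∈ ({.vertex v} : Set G.Point)} = ∅ := by
    refine eq_empty_of_forall_notMem fun t ht => ?_
    change G.chart (e, t) = _ at ht
    rcases eq_endOf_or_mem_Ioo (e, t) with ⟨b, hp⟩ | hp
    · rw [hp, chart_endOf] at ht
      exact hv _ (Point.vertex.inj ht)
    · rw [chart_of_mem_Ioo _ hp] at ht
      cases ht
  exact ⟨G.isClosed_point_iff.2 fun e => hpreimage e ▸ isClosed_empty,
    G.isOpen_point_iff.2 fun e => hpreimage e ▸ isOpen_empty⟩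

theorem fst_eq_of_chart_mem_closedEdge {e : E} (he : ∀ b, G.IsFree (G.head (e, b)))
    {p : E × unitInterval} (hp : G.chart p ∈ G.closedEdge e) : p.1 = e := by
  rw [closedEdge_eq_image_chart] at hp
  obtain ⟨q, rfl, hq⟩ := hp
  rcases eq_or_endOf_of_chart_eq hq with rfl | ⟨o, o', rfl, rfl, hhead⟩
  · rfl
  · rw [show o' = o from (he o.2).eq_of_head hhead.symm rfl]

theorem isClopen_closedEdge {e : E} (he : ∀ b, G.IsFree (G.head (e, b))) :
    IsClopen (G.closedEdge e) := by
  refine ⟨G.isClosed_closedEdge e, G.isOpen_point_iff.2 fun e' => ?_⟩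
  have hpreimage : {t : unitInterval | G.edgePoint e' t ∈ G.closedEdge e} = {_t | e' = e} := by
    ext t
    refine ⟨fun ht => fst_eq_of_chart_mem_closedEdge he (p := (e', t)) ht, ?_⟩
    rintro rfl
    exact G.chart_mem_closedEdge e' t
  exact hpreimage ▸ isOpen_const

section ConnectedSpace

variable [Finite E] [ConnectedSpace G.Point] (hdeg : ∀ v, G.degree v ≠ 2)
  (hbranched : ∃ v, G.IsBranched v)

include hdeg hbranched

theorem isFree_or_isBranched (v : V) : G.IsFree v ∨ G.IsBranched v := by
  have hdeg0 : G.degree v ≠ 0 := by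
    intro hzero
    have hv (o : G.OrientedEdge) (ho : G.head o = v) : False :=
      ((Finite.card_eq_zero_iff.1 hzero).false : {o // G.head o = v} → False) ⟨o, ho⟩
    obtain ⟨w, hw⟩ := hbranched
    have hwv : Point.vertex w ∈ ({.vertex v} : Set G.Point) :=
      (isClopen_singleton_vertex hv).eq_univ (singleton_nonempty _) ▸ mem_univ _
    obtain rfl : w = v := Point.vertex.inj hwv
    unfold IsBranched at hw
    omega
  have := hdeg v
  unfold IsFree IsBranched
  omega

theorem isBranched_head_not {e : E} {b : Bool} (h : G.IsFree (G.head (e, b))) :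
    G.IsBranched (G.head (e, !b)) := by
  refine (isFree_or_isBranched hdeg hbranched _).resolve_left fun h' => ?_
  have he (b' : Bool) : G.IsFree (G.head (e, b')) := by
    rcases Bool.eq_or_eq_not b' b with rfl | rfl <;> assumption
  obtain ⟨w, hw⟩ := hbranched
  obtain ⟨o, rfl⟩ := exists_head_of_degree_ne_zero (zero_lt_three.trans_le hw).ne'
  have hmem : G.chart (endOf o) ∈ G.closedEdge e :=
    (isClopen_closedEdge he).eq_univ ⟨_, G.chart_mem_closedEdge e 0⟩ ▸ mem_univ _
  obtain rfl : o.1 = e := fst_eq_of_chart_mem_closedEdge he hmem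
  exact (he o.2).not_isBranched hw

end ConnectedSpace

end CellGraph

theorem mainTheorem6_general {V E : Type*} [Finite E] (G : CellGraph V E)
    (hV : ∀ v, G.IsFree v ∨ G.IsBranched v)
    (hE : ∀ e b, G.IsFree (G.head (e, b)) → G.IsBranched (G.head (e, !b))) (n : ℕ) :
    (∀ f : G.cubeComplex n → G.Point, IsIdentifyingOn (G.cubeComplex n) f →
      (ExtendsToConf (G.cubeComplex n) f ↔
        CellGraph.IsExtendable (G.cubeComplex n) (G.zeroSkeleton_subset n) f)) ∧
    (∀ (A : Set (Conf n G.Point)) (h0 : G.zeroSkeleton n ⊆ A),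
      ∀ f : A → G.Point, ExtendsToConf A f → CellGraph.IsExtendable A h0 f) ∧
    ((∀ v, ¬ G.IsFree v) →
      ∀ f : G.cubeComplex n → G.Point, IsIdentifyingOn (G.cubeComplex n) f →
        ExtendsToConf (G.cubeComplex n) f) := by
  refine ⟨fun f hf => ⟨CellGraph.isExtendable_of_extendsToConf _,
      CellGraph.extendsToConf_of_isExtendable hV hE hf⟩,
    fun A h0 f => CellGraph.isExtendable_of_extendsToConf h0, fun hfree f hf =>
      CellGraph.extendsToConf_of_isExtendable hV hE hf ?_⟩
  rintro ⟨-, u, -, -, -, -, hu, -⟩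
  exact hfree u hu

theorem mainTheorem6 {V E : Type*} [Finite V] [Finite E] (G : CellGraph V E)
    [ConnectedSpace G.Point] (hdeg : ∀ v, G.degree v ≠ 2) (hbranched : ∃ v, G.IsBranched v)
    (n : ℕ) :
    (∀ f : G.cubeComplex n → G.Point, IsIdentifyingOn (G.cubeComplex n) f →
      (ExtendsToConf (G.cubeComplex n) f ↔
        CellGraph.IsExtendable (G.cubeComplex n) (G.zeroSkeleton_subset n) f)) ∧
    (∀ (A : Set (Conf n G.Point)) (h0 : G.zeroSkeleton n ⊆ A), A ⊆ G.cubeComplex n →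
      ∀ f : A → G.Point, IsIdentifyingOn A f → ExtendsToConf A f →
        CellGraph.IsExtendable A h0 f) ∧
    ((∀ v, ¬ G.IsFree v) →
      ∀ f : G.cubeComplex n → G.Point, IsIdentifyingOn (G.cubeComplex n) f →
        ExtendsToConf (G.cubeComplex n) f) := by
  obtain ⟨hiff, hext, hfree⟩ := mainTheorem6_general G
    (CellGraph.isFree_or_isBranched hdeg hbranched)
    (fun _ _ => CellGraph.isBranched_head_not hdeg hbranched) n
  exact ⟨hiff, fun A h0 _ f _ => hext A h0 f, hfree⟩
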